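/- For a random variable $U$ with variance $\sigma^2$ and continuously differentiable density $f$, let $\rho_U=f'/f$ be its score function, $J(U)=\mathbb E\,\rho_U(U)^2$ its Fisher information and $J_{\rm st}(U)=\sigma^2J(U)-1$ its standardised Fisher information. For random variables $X,Y$ and $\beta\in[0,1]$ put $$\Delta(X,Y,\beta)=\mathbb E\Big(\sqrt\beta\,\rho_X(X)+\sqrt{1-\beta}\,\rho_Y(Y)-\widetilde\rho\big(\sqrt\beta X+\sqrt{1-\beta}\,Y\big)\Big)^2,$$ where $\widetilde\rho$ is the score function of $\sqrt\beta X+\sqrt{1-\beta}\,Y$. For a function $\psi$ let $\mathcal C_\psi$ be the class of random variables $X$ with finite variance $\sigma^2$ such that $\mathbb E\,X^2\,\mathbf 1(|X|\ge R\sigma)\le\sigma^2\psi(R)$ for all $R\ge 0$. Proposition. Let $\tau>0$ and $K$ be fixed. For any function $\psi$ with $\psi(R)\to0$ as $R\to\infty$ there is a function $\nu=\nu_\psi=\nu_{\psi,\tau,K}:\mathbb R\to\mathbb R$ with $\nu(\epsilon)\to0$ as $\epsilon\to0$ and $\nu(0)=0$ such that the following holds. Let $X=S+Z_S$ and $Y=T+Z_T$,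 where $S,T$ are (possibly dependent) random variables with variances at most $K$, and $Z_S,Z_T$ are $N(0,\tau)$ variables, independent of $(S,T)$ and of each other. If $X,Y\in\mathcal C_\psi$, then for every $\beta\in[0,1]$ the variables $X$, $Y$ and $\sqrt\beta X+\sqrt{1-\beta}\,Y$ have continuously differentiable densities, $J(X)$ and $\Delta(X,Y,\beta)$ are finite, and $$\beta(1-\beta)\,J_{\rm st}(X)\le\nu\big(\Delta(X,Y,\beta)\big).$$ -/

import Mathlib

open MeasureTheory ProbabilityTheory Filter Topology
open scoped NNReal ENNReal

noncomputable section

/-- `f` is a nonnegative continuously differentiable Lebesgue density of `μ`. -/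
def IsSmoothDensity (μ : Measure ℝ) (f : ℝ → ℝ) : Prop :=
  ContDiff ℝ 1 f ∧ (∀ x, 0 ≤ f x) ∧ μ = volume.withDensity (fun x => ENNReal.ofReal (f x))

/-- A finite measure has at most one smooth density, so that densities and scores below are
canonical, pointwise defined functions. -/
theorem IsSmoothDensity.unique {μ : Measure ℝ} [IsFiniteMeasure μ] {f g : ℝ → ℝ}
    (hf : IsSmoothDensity μ f) (hg : IsSmoothDensity μ g) : f = g := by
  obtain ⟨hfc, hf0, hfd⟩ := hf
  obtain ⟨hgc, hg0, hgd⟩ := hg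
  have hfm : Measurable (fun x => ENNReal.ofReal (f x)) :=
    hfc.continuous.measurable.ennreal_ofReal
  have hgm : Measurable (fun x => ENNReal.ofReal (g x)) :=
    hgc.continuous.measurable.ennreal_ofReal
  have hfin : ∫⁻ x, ENNReal.ofReal (f x) ≠ ∞ := by
    have h : μ Set.univ ≠ ∞ := measure_ne_top μ _
    rwa [hfd, withDensity_apply _ MeasurableSet.univ, Measure.restrict_univ] at h
  have hae : (fun x => ENNReal.ofReal (f x)) =ᵐ[volume] (fun x => ENNReal.ofReal (g x)) :=
    (withDensity_eq_iff hfm.aemeasurable hgm.aemeasurable hfin).1 (hfd.symm.trans hgd)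
  have hae' : f =ᵐ[volume] g := by
    filter_upwards [hae] with x hx
    exact (ENNReal.ofReal_eq_ofReal_iff (hf0 x) (hg0 x)).1 hx
  exact (Continuous.ae_eq_iff_eq volume hfc.continuous hgc.continuous).1 hae'

open Classical in
/-- The smooth density of `μ` (and `0` if there is none). -/
def smoothDensity (μ : Measure ℝ) : ℝ → ℝ :=
  if h : ∃ f, IsSmoothDensity μ f then h.choose else 0

section RandomVariables

variable {Ω : Type*} [MeasurableSpace Ω]

/-- The random variable `U` has a smooth density. -/
def HasSmoothDensity (U : Ω → ℝ) (P : Measure Ω) : Prop :=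
  ∃ f, IsSmoothDensity (P.map U) f

/-- The score function `ρ = f' / f`, for `f` the smooth density of `U`. -/
def score (U : Ω → ℝ) (P : Measure Ω) (u : ℝ) : ℝ :=
  deriv (smoothDensity (P.map U)) u / smoothDensity (P.map U) u

/-- The Fisher information `J(U) = E ρ(U)²`. -/
def fisherInfo (U : Ω → ℝ) (P : Measure Ω) : ℝ :=
  ∫ ω, score U P (U ω) ^ 2 ∂P

/-- The standardised Fisher information `J_st(U) = σ² J(U) - 1`, with `σ²` the variance of `U`. -/
def stdFisherInfo (U : Ω → ℝ) (P : Measure Ω) : ℝ :=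
  variance U P * fisherInfo U P - 1

/-- The normalised sum `√β X + √(1-β) Y`. -/
def mix (X Y : Ω → ℝ) (β : ℝ) (ω : Ω) : ℝ :=
  √β * X ω + √(1 - β) * Y ω

/-- The defect
`√β ρ_X(X) + √(1-β) ρ_Y(Y) - ρ̃(√β X + √(1-β) Y)`, `ρ̃` the score of `√β X + √(1-β) Y`. -/
def scoreDefect (X Y : Ω → ℝ) (β : ℝ) (P : Measure Ω) (ω : Ω) : ℝ :=
  √β * score X P (X ω) + √(1 - β) * score Y P (Y ω) - score (mix X Y β) P (mix X Y β ω)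

/-- `Δ(X, Y, β)`, the second moment of the score defect. -/
def Delta (X Y : Ω → ℝ) (β : ℝ) (P : Measure Ω) : ℝ :=
  ∫ ω, scoreDefect X Y β P ω ^ 2 ∂P

/-- Membership of `X` in the class `C_ψ`: `X` has finite variance `σ²` and
`E X² 1(|X| ≥ R σ) ≤ σ² ψ(R)` for all `R ≥ 0`. -/
def InTailClass (ψ : ℝ → ℝ) (X : Ω → ℝ) (P : Measure Ω) : Prop :=
  MemLp X 2 P ∧ ∀ R : ℝ, 0 ≤ R →
    ∫ ω in {ω | R * √(variance X P) ≤ |X ω|}, X ω ^ 2 ∂P ≤ variance X P * ψ R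

/-- `Z_S`, `Z_T` are `N(0, τ)`, independent of the pair `(S, T)` and of each other. -/
structure IsGaussianPerturbation (S T ZS ZT : Ω → ℝ) (τ : ℝ≥0) (P : Measure Ω) : Prop where
  law_left : HasLaw ZS (gaussianReal 0 τ) P
  law_right : HasLaw ZT (gaussianReal 0 τ) P
  indep_noise : IndepFun ZS ZT P
  indep : IndepFun (fun ω => (S ω, T ω)) (fun ω => (ZS ω, ZT ω)) P

end RandomVariables

end

/-!
If `Δ` is small, then `√β F(x) + √(1-β) G(y)` is close to `k(√β x + √(1-β) y)` at every point of a
large box, where `F`, `G` and `k` are the scores of `X`, `Y` and the mixture: the Gaussian noise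
gives the joint law of `(X, Y)` a density bounded below on boxes, and the scores are Lipschitz on
compact sets, both with constants that depend only on `τ` and on second moments. Eliminating `G` and
`k` makes `F - F(0)` almost additive, hence almost linear on a bounded interval (Hyers–Ulam
stability). Finally `J_st(X)` is at most `σ²` times the squared `L²(X)`-distance of `F` to any
affine function; outside the interval this distance is controlled by the linear growth of `F` and
the tail condition `C_ψ`. If `β (1-β)` is small, a uniform bound on `J_st(X)` suffices.
-/

section SmoothDensity

variable {μ : Measure ℝ} {f g : ℝ → ℝ}

theorem isSmoothDensity_smoothDensity (h : ∃ f, IsSmoothDensity μ f) :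
    IsSmoothDensity μ (smoothDensity μ) := by
  rw [smoothDensity, dif_pos h]
  exact h.choose_spec

namespace IsSmoothDensity

theorem smoothDensity_eq [IsFiniteMeasure μ] (hf : IsSmoothDensity μ f) : smoothDensity μ = f :=
  (isSmoothDensity_smoothDensity ⟨f, hf⟩).unique hf

theorem measurable_logDeriv (hf : IsSmoothDensity μ f) : Measurable (logDeriv f) :=
  (measurable_deriv f).div hf.1.continuous.measurable

theorem hasDerivAt (hf : IsSmoothDensity μ f) (x : ℝ) : HasDerivAt f (deriv f x) x :=
  (hf.1.differentiable one_ne_zero x).hasDerivAt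

theorem mul_logDeriv (hf : IsSmoothDensity μ f) (x : ℝ) : f x * logDeriv f x = deriv f x := by
  rw [logDeriv_apply]
  by_cases hx : f x = 0
  · -- a zero of the nonnegative function `f` is a minimum, so the junk value `0 / 0 = 0` is right
    have hmin : IsLocalMin f x := Eventually.of_forall fun y => hx.trans_le (hf.2.1 y)
    rw [hmin.deriv_eq_zero, zero_div, mul_zero]
  · exact mul_div_cancel₀ _ hx

theorem integrable_iff (hf : IsSmoothDensity μ f) :
    Integrable g μ ↔ Integrable fun x => f x * g x := by
  rw [hf.2.2, integrable_withDensity_iff_integrable_smul'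
    hf.1.continuous.measurable.ennreal_ofReal (Eventually.of_forall fun _ => ENNReal.ofReal_lt_top)]
  simp only [ENNReal.toReal_ofReal (hf.2.1 _), smul_eq_mul]

theorem integral_eq (hf : IsSmoothDensity μ f) (g : ℝ → ℝ) :
    ∫ x, g x ∂μ = ∫ x, f x * g x := by
  rw [hf.2.2, integral_withDensity_eq_integral_toReal_smul
    hf.1.continuous.measurable.ennreal_ofReal (Eventually.of_forall fun _ => ENNReal.ofReal_lt_top)]
  simp only [ENNReal.toReal_ofReal (hf.2.1 _), smul_eq_mul]

theorem integrable [IsFiniteMeasure μ] (hf : IsSmoothDensity μ f) : Integrable f := by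
  simpa only [mul_one] using hf.integrable_iff.1 (integrable_const (1 : ℝ))

theorem integral_logDeriv [IsFiniteMeasure μ] (hf : IsSmoothDensity μ f)
    (hi : Integrable (logDeriv f) μ) : ∫ x, logDeriv f x ∂μ = 0 := by
  have hi' := hf.integrable_iff.1 hi
  rw [hf.integral_eq]
  simp only [hf.mul_logDeriv] at hi' ⊢
  exact integral_eq_zero_of_hasDerivAt_of_integrable hf.hasDerivAt hi' hf.integrable

theorem integral_mul_logDeriv [IsProbabilityMeasure μ] (hf : IsSmoothDensity μ f)
    (hid : Integrable (fun x => x) μ) (hi : Integrable (fun x => x * logDeriv f x) μ) :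
    ∫ x, x * logDeriv f x ∂μ = -1 := by
  have hone : ∫ x, f x = 1 := by
    simpa only [mul_one, integral_const, probReal_univ, one_smul] using
      (hf.integral_eq fun _ => (1 : ℝ)).symm
  have hi' := hf.integrable_iff.1 hi
  rw [hf.integral_eq]
  simp only [mul_left_comm (f _), hf.mul_logDeriv] at hi' ⊢
  have hparts := integral_mul_deriv_eq_deriv_mul_of_integrable (u := fun x : ℝ => x)
    (u' := fun _ => 1) (fun x _ => hasDerivAt_id x) (fun x _ => hf.hasDerivAt x) hi'
    (by simpa only [Pi.mul_def, one_mul] using hf.integrable)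
    (by simpa only [Pi.mul_def, mul_comm] using hf.integrable_iff.1 hid)
  simpa only [one_mul, hone] using hparts

theorem map_add_const (hf : IsSmoothDensity μ f) (c : ℝ) :
    IsSmoothDensity (μ.map (· + c)) fun x => f (x - c) := by
  refine ⟨hf.1.comp (contDiff_id.sub contDiff_const), fun x => hf.2.1 _, ?_⟩
  ext B hB
  have hB' : MeasurableSet ((· + c) ⁻¹' B) := hB.preimage (measurable_add_const c)
  rw [Measure.map_apply (measurable_add_const c) hB, hf.2.2, withDensity_apply _ hB,
    withDensity_apply _ hB', ← lintegral_indicator hB, ← lintegral_indicator hB',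
    ← lintegral_add_right_eq_self (B.indicator _) c]
  refine lintegral_congr fun x => ?_
  simp only [Set.indicator, add_sub_cancel_right]
  rfl

end IsSmoothDensity

end SmoothDensity

section Score

variable {Ω : Type*} [MeasurableSpace Ω] {P : Measure Ω} {U : Ω → ℝ}

theorem HasSmoothDensity.isSmoothDensity (hU : HasSmoothDensity U P) :
    IsSmoothDensity (P.map U) (smoothDensity (P.map U)) :=
  isSmoothDensity_smoothDensity hU

theorem HasSmoothDensity.measurable_score (hU : HasSmoothDensity U P) : Measurable (score U P) :=
  hU.isSmoothDensity.measurable_logDeriv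

theorem IsSmoothDensity.score_eq [IsFiniteMeasure P] {f : ℝ → ℝ}
    (hf : IsSmoothDensity (P.map U) f) : score U P = logDeriv f := by
  rw [← hf.smoothDensity_eq]
  rfl

namespace HasSmoothDensity

theorem score_add_const [IsFiniteMeasure P] (hU : HasSmoothDensity U P)
    (hUm : AEMeasurable U P) (c x : ℝ) :
    score (fun ω => U ω + c) P (x + c) = score U P x := by
  have hmap : P.map (fun ω => U ω + c) = (P.map U).map (· + c) :=
    (AEMeasurable.map_map_of_aemeasurable (measurable_add_const c).aemeasurable hUm).symm
  have hfc : IsSmoothDensity (P.map fun ω => U ω + c) fun x => smoothDensity (P.map U) (x - c) :=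
    hmap ▸ hU.isSmoothDensity.map_add_const c
  rw [hfc.score_eq, logDeriv_apply, deriv_comp_sub_const, add_sub_cancel_right, score]

theorem integral_score [IsFiniteMeasure P] (hU : HasSmoothDensity U P) (hUm : AEMeasurable U P)
    (hs : Integrable (fun ω => score U P (U ω)) P) : ∫ ω, score U P (U ω) ∂P = 0 := by
  have hm := hU.measurable_score.aestronglyMeasurable (μ := P.map U)
  rw [← integral_map hUm hm]
  exact hU.isSmoothDensity.integral_logDeriv ((integrable_map_measure hm hUm).2 hs)

variable [IsProbabilityMeasure P]

theorem integral_mul_score (hU : HasSmoothDensity U P) (hU1 : Integrable U P)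
    (hs : Integrable (fun ω => U ω * score U P (U ω)) P) :
    ∫ ω, U ω * score U P (U ω) ∂P = -1 := by
  have hUm := hU1.aemeasurable
  have := Measure.isProbabilityMeasure_map hUm
  have hm : AEStronglyMeasurable (fun x => x * score U P x) (P.map U) :=
    (measurable_id.mul hU.measurable_score).aestronglyMeasurable
  rw [← integral_map hUm hm]
  exact hU.isSmoothDensity.integral_mul_logDeriv
    ((integrable_map_measure (by fun_prop) hUm).2 hU1) ((integrable_map_measure hm hUm).2 hs)

theorem variance_pos (hU : HasSmoothDensity U P) (hU2 : MemLp U 2 P) : 0 < variance U P := by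
  refine (variance_nonneg _ _).lt_of_ne fun h0 => ?_
  have hconst : U =ᵐ[P] fun _ => ∫ ω, U ω ∂P := by
    refine (evariance_eq_zero_iff hU2.aemeasurable).1 ?_
    rw [← hU2.ofReal_variance_eq, ← h0, ENNReal.ofReal_zero]
  have hdirac : P.map U {∫ ω, U ω ∂P} = 1 := by
    rw [Measure.map_congr hconst, Measure.map_const]
    simp
  have hnull : P.map U {∫ ω, U ω ∂P} = 0 := by
    rw [hU.isSmoothDensity.2.2]
    exact withDensity_absolutelyContinuous _ _ (measure_singleton _)
  exact one_ne_zero (hdirac.symm.trans hnull)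

theorem integral_score_sub_affine_sq (hU : HasSmoothDensity U P) (hU2 : MemLp U 2 P)
    (hs : MemLp (fun ω => score U P (U ω)) 2 P) (a b : ℝ) :
    ∫ ω, (score U P (U ω) - (a + b * U ω)) ^ 2 ∂P
      = fisherInfo U P + 2 * b + b ^ 2 * variance U P + (a + b * ∫ ω, U ω ∂P) ^ 2 := by
  have hs1 := hs.integrable one_le_two
  have hU1 := hU2.integrable one_le_two
  have hUs : Integrable (fun ω => U ω * score U P (U ω)) P := hU2.integrable_mul hs
  have hUsq := hU2.integrable_sq
  have hssq := hs.integrable_sq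
  have hvar : variance U P = ∫ ω, U ω ^ 2 ∂P - (∫ ω, U ω ∂P) ^ 2 := variance_eq_sub hU2
  have hexpand : ∀ ω, (score U P (U ω) - (a + b * U ω)) ^ 2
      = score U P (U ω) ^ 2 + (-2 * a) * score U P (U ω)
        + (-2 * b) * (U ω * score U P (U ω)) + b ^ 2 * U ω ^ 2 + (2 * a * b) * U ω + a ^ 2 :=
    fun ω => by ring
  simp_rw [hexpand]
  rw [integral_add (by fun_prop) (by fun_prop), integral_add (by fun_prop) (by fun_prop),
    integral_add (by fun_prop) (by fun_prop), integral_add (by fun_prop) (by fun_prop),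
    integral_add (by fun_prop) (by fun_prop), integral_const_mul, integral_const_mul,
    integral_const_mul, integral_const_mul, hU.integral_score hU2.aemeasurable hs1,
    hU.integral_mul_score hU1 hUs, hvar, fisherInfo]
  simp only [integral_const, probReal_univ, one_smul]
  ring

theorem stdFisherInfo_le (hU : HasSmoothDensity U P) (hU2 : MemLp U 2 P)
    (hs : MemLp (fun ω => score U P (U ω)) 2 P) (a b : ℝ) :
    stdFisherInfo U P ≤ variance U P * ∫ ω, (score U P (U ω) - (a + b * U ω)) ^ 2 ∂P := by
  -- The minimum over affine functions is attained at `-(U - 𝔼 U) / σ²`, where equality holds.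
  have hpos := hU.variance_pos hU2
  rw [stdFisherInfo, hU.integral_score_sub_affine_sq hU2 hs]
  nlinarith [sq_nonneg (b * variance U P + 1),
    mul_nonneg hpos.le (sq_nonneg (a + b * ∫ ω, U ω ∂P))]

theorem stdFisherInfo_le_of_affine_approx (hU : HasSmoothDensity U P) (hU2 : MemLp U 2 P)
    (hs : MemLp (fun ω => score U P (U ω)) 2 P) {a b e D R : ℝ}
    (happrox : ∀ x, |x| < R → |score U P x - (a + b * x)| ≤ e)
    (hgrowth : ∀ x, R ≤ |x| → |score U P x - (a + b * x)| ≤ D * |x|) :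
    stdFisherInfo U P
      ≤ variance U P * (e ^ 2 + D ^ 2 * ∫ ω in {ω | R ≤ |U ω|}, U ω ^ 2 ∂P) := by
  set A : Set Ω := {ω | R ≤ |U ω|}
  have hA : NullMeasurableSet A P :=
    nullMeasurableSet_le aemeasurable_const hU2.aemeasurable.abs
  have hint : Integrable (A.indicator fun ω => U ω ^ 2) P := hU2.integrable_sq.indicator₀ hA
  have hpt : ∀ ω, (score U P (U ω) - (a + b * U ω)) ^ 2
      ≤ e ^ 2 + D ^ 2 * A.indicator (fun ω => U ω ^ 2) ω := fun ω => by
    rw [← sq_abs]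
    by_cases hω : ω ∈ A
    · rw [Set.indicator_of_mem hω, ← sq_abs (U ω), ← mul_pow]
      exact le_add_of_nonneg_of_le (sq_nonneg _) (by gcongr; exact hgrowth _ hω)
    · rw [Set.indicator_of_notMem hω, mul_zero, add_zero]
      gcongr
      exact happrox _ (not_le.1 hω)
  refine (hU.stdFisherInfo_le hU2 hs a b).trans ?_
  gcongr
  · exact variance_nonneg _ _
  calc ∫ ω, (score U P (U ω) - (a + b * U ω)) ^ 2 ∂P
      ≤ ∫ ω, e ^ 2 + D ^ 2 * A.indicator (fun ω => U ω ^ 2) ω ∂P := by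
        refine integral_mono ?_ ((integrable_const _).add (hint.const_mul _)) hpt
        exact (hs.sub ((memLp_const a).add (hU2.const_mul b))).integrable_sq
    _ = e ^ 2 + D ^ 2 * ∫ ω in A, U ω ^ 2 ∂P := by
        rw [integral_add (integrable_const _) (hint.const_mul _), integral_const_mul,
          integral_indicator₀ hA, integral_const, probReal_univ, one_smul]

end HasSmoothDensity

end Score

section ConvMeasure

/-- The convolution `x ↦ ∫ s, f (x - s) ∂μ` of a function with a measure, which for a Lebesgue
density `f` is a density of the convolution of measures. -/
noncomputable def convMeasure (f : ℝ → ℝ) (μ : Measure ℝ) (x : ℝ) : ℝ := ∫ s, f (x - s) ∂μ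

variable {f f' : ℝ → ℝ} {C : ℝ} {L : ℝ≥0} {μ : Measure ℝ}

theorem convMeasure_nonneg (hf : ∀ x, 0 ≤ f x) (x : ℝ) : 0 ≤ convMeasure f μ x :=
  integral_nonneg fun _ => hf _

variable [IsProbabilityMeasure μ]

theorem integrable_comp_const_sub (hf : Continuous f) (hC : ∀ x, |f x| ≤ C) (x : ℝ) :
    Integrable (fun s => f (x - s)) μ :=
  .of_bound (hf.comp (continuous_const.sub continuous_id)).aestronglyMeasurable C
    (Eventually.of_forall fun _ => hC _)

theorem abs_convMeasure_le (hC : ∀ x, |f x| ≤ C) (x : ℝ) : |convMeasure f μ x| ≤ C := by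
  have h := norm_integral_le_of_norm_le_const (μ := μ) (f := fun s => f (x - s))
    (Eventually.of_forall fun s => hC (x - s))
  rwa [probReal_univ, mul_one] at h

theorem lipschitzWith_convMeasure (hC : ∀ x, |f x| ≤ C) (hf : LipschitzWith L f) :
    LipschitzWith L (convMeasure f μ) := by
  refine .of_dist_le_mul fun x y => ?_
  have hbound : ∀ s, ‖f (x - s) - f (y - s)‖ ≤ L * dist x y := fun s => by
    simpa only [dist_sub_right, ← dist_eq_norm] using hf.dist_le_mul (x - s) (y - s)
  have h := norm_integral_le_of_norm_le_const (μ := μ) (Eventually.of_forall hbound)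
  rwa [probReal_univ, mul_one, integral_sub (integrable_comp_const_sub hf.continuous hC x)
    (integrable_comp_const_sub hf.continuous hC y), ← dist_eq_norm] at h

theorem hasDerivAt_convMeasure {C' : ℝ} (hC : ∀ x, |f x| ≤ C) (hf' : Continuous f')
    (hC' : ∀ x, |f' x| ≤ C') (hderiv : ∀ x, HasDerivAt f (f' x) x) (x : ℝ) :
    HasDerivAt (convMeasure f μ) (convMeasure f' μ x) x := by
  have hf : Continuous f := continuous_iff_continuousAt.2 fun x => (hderiv x).continuousAt
  exact (hasDerivAt_integral_of_dominated_loc_of_deriv_le (F := fun x s => f (x - s))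
    (F' := fun x s => f' (x - s)) (bound := fun _ => C') univ_mem
    (Eventually.of_forall fun y => (integrable_comp_const_sub hf hC y).1)
    (integrable_comp_const_sub hf hC x) (integrable_comp_const_sub hf' hC' x).1
    (Eventually.of_forall fun s y _ => hC' _) (integrable_const C')
    (Eventually.of_forall fun s y _ => (hderiv (y - s)).comp_sub_const y s)).2

end ConvMeasure

section GaussianKernel

theorem hasDerivAt_gaussianPDFReal (m : ℝ) (v : ℝ≥0) (x : ℝ) :
    HasDerivAt (gaussianPDFReal m v) (-((x - m) / v) * gaussianPDFReal m v x) x := by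
  rw [gaussianPDFReal_def]
  have h := ((((hasDerivAt_id x).sub_const m).pow 2).neg.div_const (2 * (v : ℝ))).exp.const_mul
    (√(2 * Real.pi * v))⁻¹
  refine h.congr_deriv ?_
  simp only [Pi.pow_apply, Pi.neg_apply, id]
  rw [show (2 * (v : ℝ)) = v * 2 from mul_comm _ _]
  ring

variable {τ : ℝ≥0}

theorem gaussianPDFReal_eq_mul_exp (τ : ℝ≥0) (z : ℝ) :
    gaussianPDFReal 0 τ z = gaussianPDFReal 0 τ 0 * Real.exp (-(z ^ 2 / (2 * τ))) := by
  simp [gaussianPDFReal, neg_div]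

theorem exp_neg_sq_div_le_one (τ : ℝ≥0) (z : ℝ) : Real.exp (-(z ^ 2 / τ)) ≤ 1 :=
  Real.exp_le_one_iff.2 (neg_nonpos.2 (by positivity))

theorem sq_mul_exp_neg_sq_div_le (hτ : 0 < τ) (z : ℝ) : z ^ 2 * Real.exp (-(z ^ 2 / τ)) ≤ τ := by
  have hτ' : (0 : ℝ) < τ := hτ
  have h : z ^ 2 / τ ≤ Real.exp (z ^ 2 / τ) := by linarith [Real.add_one_le_exp (z ^ 2 / τ)]
  rwa [Real.exp_neg, ← div_eq_mul_inv, div_le_iff₀ (Real.exp_pos _), mul_comm, ← div_le_iff₀ hτ']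

theorem abs_mul_exp_neg_sq_div_le (hτ : 0 < τ) (z : ℝ) :
    |z| * Real.exp (-(z ^ 2 / τ)) ≤ 1 + τ := by
  have habs : |z| ≤ 1 + z ^ 2 := by nlinarith [sq_abs z, sq_nonneg (|z| - 1), abs_nonneg z]
  calc |z| * Real.exp (-(z ^ 2 / τ)) ≤ (1 + z ^ 2) * Real.exp (-(z ^ 2 / τ)) := by gcongr
    _ = Real.exp (-(z ^ 2 / τ)) + z ^ 2 * Real.exp (-(z ^ 2 / τ)) := by ring
    _ ≤ 1 + τ := add_le_add (exp_neg_sq_div_le_one τ z) (sq_mul_exp_neg_sq_div_le hτ z)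

theorem abs_gaussianPDFReal_le (z : ℝ) : |gaussianPDFReal 0 τ z| ≤ gaussianPDFReal 0 τ 0 := by
  have hexp := exp_neg_sq_div_le_one (2 * τ) z
  push_cast at hexp
  rw [abs_of_nonneg (gaussianPDFReal_nonneg _ _ _), gaussianPDFReal_eq_mul_exp τ z]
  exact mul_le_of_le_one_right (gaussianPDFReal_nonneg _ _ _) hexp

/-- The derivative `φ'(z) = -(z / τ) φ(z)` of the density `φ` of `N(0, τ)`. -/
noncomputable def gaussianPDFDeriv (τ : ℝ≥0) (z : ℝ) : ℝ := -(z / τ) * gaussianPDFReal 0 τ z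

theorem hasDerivAt_gaussianPDFReal_zero (τ : ℝ≥0) (z : ℝ) :
    HasDerivAt (gaussianPDFReal 0 τ) (gaussianPDFDeriv τ z) z := by
  simpa only [gaussianPDFDeriv, sub_zero] using hasDerivAt_gaussianPDFReal 0 τ z

theorem hasDerivAt_gaussianPDFDeriv (τ : ℝ≥0) (z : ℝ) :
    HasDerivAt (gaussianPDFDeriv τ) ((z ^ 2 / τ ^ 2 - 1 / τ) * gaussianPDFReal 0 τ z) z := by
  refine (((hasDerivAt_id z).div_const (τ : ℝ)).neg.mul
    (hasDerivAt_gaussianPDFReal_zero τ z)).congr_deriv ?_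
  simp only [gaussianPDFDeriv, Pi.neg_apply, id]
  ring

theorem abs_gaussianPDFDeriv (τ : ℝ≥0) (z : ℝ) :
    |gaussianPDFDeriv τ z| = |z| / τ * gaussianPDFReal 0 τ z := by
  rw [gaussianPDFDeriv, abs_mul, abs_neg, abs_div, NNReal.abs_eq,
    abs_of_nonneg (gaussianPDFReal_nonneg _ _ _)]

theorem abs_gaussianPDFDeriv_le (hτ : 0 < τ) (z : ℝ) :
    |gaussianPDFDeriv τ z| ≤ (1 + 2 * τ) / τ * gaussianPDFReal 0 τ 0 := by
  have hexp := abs_mul_exp_neg_sq_div_le (mul_pos two_pos hτ) z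
  push_cast at hexp
  rw [abs_gaussianPDFDeriv, gaussianPDFReal_eq_mul_exp τ z]
  calc |z| / τ * (gaussianPDFReal 0 τ 0 * Real.exp (-(z ^ 2 / (2 * τ))))
      = (|z| * Real.exp (-(z ^ 2 / (2 * τ)))) / τ * gaussianPDFReal 0 τ 0 := by ring
    _ ≤ (1 + 2 * τ) / τ * gaussianPDFReal 0 τ 0 :=
        mul_le_mul_of_nonneg_right (by gcongr) (gaussianPDFReal_nonneg _ _ _)

theorem exists_lipschitzWith_gaussianPDFDeriv (hτ : 0 < τ) :
    ∃ L : ℝ≥0, LipschitzWith L (gaussianPDFDeriv τ) := by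
  set φ₀ := gaussianPDFReal 0 τ 0
  have hφ₀ : 0 ≤ φ₀ := gaussianPDFReal_nonneg _ _ _
  refine ⟨((2 * τ / τ ^ 2 + 1 / τ) * φ₀).toNNReal, lipschitzWith_of_nnnorm_deriv_le
    (fun z => (hasDerivAt_gaussianPDFDeriv τ z).differentiableAt) fun z => ?_⟩
  rw [(hasDerivAt_gaussianPDFDeriv τ z).deriv, ← NNReal.coe_le_coe, coe_nnnorm, Real.norm_eq_abs,
    Real.coe_toNNReal _ (by positivity), abs_mul,
    abs_of_nonneg (gaussianPDFReal_nonneg 0 τ z), gaussianPDFReal_eq_mul_exp τ z]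
  have hexp := exp_neg_sq_div_le_one (2 * τ) z
  have hsq := sq_mul_exp_neg_sq_div_le (mul_pos two_pos hτ) z
  push_cast at hexp hsq
  set E := Real.exp (-(z ^ 2 / (2 * τ)))
  have hfactor : |z ^ 2 / (τ : ℝ) ^ 2 - 1 / τ| ≤ z ^ 2 / τ ^ 2 + 1 / τ :=
    (abs_sub _ _).trans_eq (by rw [abs_of_nonneg (by positivity), abs_of_nonneg (by positivity)])
  calc |z ^ 2 / (τ : ℝ) ^ 2 - 1 / τ| * (φ₀ * E) ≤ (z ^ 2 / τ ^ 2 + 1 / τ) * (φ₀ * E) :=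
        mul_le_mul_of_nonneg_right hfactor (by positivity)
    _ = (z ^ 2 * E / τ ^ 2 + 1 / τ * E) * φ₀ := by ring
    _ ≤ (2 * τ / τ ^ 2 + 1 / τ * 1) * φ₀ := by gcongr
    _ = (2 * τ / τ ^ 2 + 1 / τ) * φ₀ := by rw [mul_one]

theorem gaussianPDFReal_sub_ge (hτ : 0 < τ) (x s : ℝ) :
    gaussianPDFReal 0 τ 0 * Real.exp (-(x ^ 2 / τ)) * Real.exp (-(s ^ 2 / τ))
      ≤ gaussianPDFReal 0 τ (x - s) := by
  have hτ' : (0 : ℝ) < τ := hτ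
  rw [gaussianPDFReal_eq_mul_exp τ (x - s), mul_assoc, ← Real.exp_add]
  refine mul_le_mul_of_nonneg_left (Real.exp_le_exp.2 ?_) (gaussianPDFReal_nonneg _ _ _)
  rw [← neg_add, neg_le_neg_iff, ← add_div, div_le_div_iff₀ (by positivity) hτ']
  nlinarith [mul_nonneg hτ'.le (sq_nonneg (x + s))]

theorem abs_gaussianPDFDeriv_le_add (hτ : 0 < τ) (x z : ℝ) :
    |gaussianPDFDeriv τ z| ≤ 2 * |x| / τ * gaussianPDFReal 0 τ z
      + (1 + 4 * τ) / τ * (gaussianPDFReal 0 τ 0 * Real.exp (-(x ^ 2 / τ))) := by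
  have hτ' : (0 : ℝ) < τ := hτ
  have hφ₀ := gaussianPDFReal_nonneg 0 τ 0
  have hφ := gaussianPDFReal_nonneg 0 τ z
  rw [abs_gaussianPDFDeriv]
  -- The first term bounds the part `|z| ≤ 2 |x|`, the second one the part `|z| ≥ 2 |x|`.
  rcases le_total |z| (2 * |x|) with h | h
  · exact le_add_of_le_of_nonneg (by gcongr) (by positivity)
  refine le_add_of_nonneg_of_le (by positivity) ?_
  have hsq : 4 * x ^ 2 ≤ z ^ 2 := by
    calc 4 * x ^ 2 = (2 * |x|) ^ 2 := by rw [mul_pow, sq_abs]; norm_num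
      _ ≤ z ^ 2 := by rw [← sq_abs z]; gcongr
  have hexp : Real.exp (-(z ^ 2 / (4 * τ))) ≤ Real.exp (-(x ^ 2 / τ)) := by
    rw [Real.exp_le_exp, neg_le_neg_iff, div_le_div_iff₀ hτ' (by positivity)]
    nlinarith
  have hlin := abs_mul_exp_neg_sq_div_le (mul_pos four_pos hτ) z
  push_cast at hlin
  have hsplit : Real.exp (-(z ^ 2 / (2 * τ)))
      = Real.exp (-(z ^ 2 / (4 * τ))) * Real.exp (-(z ^ 2 / (4 * τ))) := by
    rw [← Real.exp_add]
    congr 1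
    field_simp
    ring
  rw [gaussianPDFReal_eq_mul_exp τ z, hsplit]
  set φ₀ := gaussianPDFReal 0 τ 0
  set E := Real.exp (-(z ^ 2 / (4 * τ)))
  calc |z| / τ * (φ₀ * (E * E)) = |z| * E / τ * (φ₀ * E) := by ring
    _ ≤ (1 + 4 * τ) / τ * (φ₀ * Real.exp (-(x ^ 2 / τ))) := by gcongr

end GaussianKernel

theorem integrable_exp_neg {α : Type*} [MeasurableSpace α] {μ : Measure α} [IsFiniteMeasure μ]
    {f : α → ℝ} (hf : AEStronglyMeasurable f μ) (hf0 : ∀ a, 0 ≤ f a) :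
    Integrable (fun a => Real.exp (-f a)) μ := by
  refine .of_bound (Real.continuous_exp.comp_aestronglyMeasurable hf.neg) 1
    (Eventually.of_forall fun a => ?_)
  rw [Real.norm_of_nonneg (Real.exp_pos _).le]
  exact Real.exp_le_one_iff.2 (neg_nonpos.2 (hf0 a))

theorem exp_neg_integral_le {α : Type*} [MeasurableSpace α] {μ : Measure α} [IsProbabilityMeasure μ]
    {f : α → ℝ} (hf : Integrable f μ) (hf0 : ∀ a, 0 ≤ f a) :
    Real.exp (-∫ a, f a ∂μ) ≤ ∫ a, Real.exp (-f a) ∂μ := by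
  rw [← integral_neg]
  exact convexOn_exp.map_integral_le Real.continuous_exp.continuousOn isClosed_univ
    (Eventually.of_forall fun _ => Set.mem_univ _) hf.neg (integrable_exp_neg hf.1 hf0)

section GaussianConv

/-- The density of `μ ∗ N(0, τ)`. -/
noncomputable def gaussianConvPDF (τ : ℝ≥0) (μ : Measure ℝ) : ℝ → ℝ :=
  convMeasure (gaussianPDFReal 0 τ) μ

variable {τ : ℝ≥0} {μ : Measure ℝ} [IsProbabilityMeasure μ]

theorem hasDerivAt_gaussianConvPDF (hτ : 0 < τ) (x : ℝ) :
    HasDerivAt (gaussianConvPDF τ μ) (convMeasure (gaussianPDFDeriv τ) μ x) x := by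
  obtain ⟨L, hL⟩ := exists_lipschitzWith_gaussianPDFDeriv hτ
  exact hasDerivAt_convMeasure abs_gaussianPDFReal_le hL.continuous (abs_gaussianPDFDeriv_le hτ)
    (hasDerivAt_gaussianPDFReal_zero τ) x

theorem logDeriv_gaussianConvPDF (hτ : 0 < τ) (x : ℝ) :
    logDeriv (gaussianConvPDF τ μ) x
      = convMeasure (gaussianPDFDeriv τ) μ x / gaussianConvPDF τ μ x := by
  rw [logDeriv_apply, (hasDerivAt_gaussianConvPDF hτ x).deriv]

theorem contDiff_gaussianConvPDF (hτ : 0 < τ) : ContDiff ℝ 1 (gaussianConvPDF τ μ) := by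
  obtain ⟨L, hL⟩ := exists_lipschitzWith_gaussianPDFDeriv hτ
  refine contDiff_one_iff_deriv.2
    ⟨fun x => (hasDerivAt_gaussianConvPDF hτ x).differentiableAt, ?_⟩
  rw [funext fun x => (hasDerivAt_gaussianConvPDF (μ := μ) hτ x).deriv]
  exact (lipschitzWith_convMeasure (abs_gaussianPDFDeriv_le hτ) hL).continuous

theorem integrable_gaussianPDFReal_const_sub (x : ℝ) :
    Integrable (fun s => gaussianPDFReal 0 τ (x - s)) μ :=
  integrable_comp_const_sub (continuous_iff_continuousAt.2 fun z =>
    (hasDerivAt_gaussianPDFReal_zero τ z).continuousAt) abs_gaussianPDFReal_le x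

theorem isSmoothDensity_gaussianConvPDF (hτ : 0 < τ) :
    IsSmoothDensity (μ ∗ gaussianReal 0 τ) (gaussianConvPDF τ μ) := by
  refine ⟨contDiff_gaussianConvPDF hτ, convMeasure_nonneg (gaussianPDFReal_nonneg 0 τ), ?_⟩
  have hmeas : Measurable fun q : ℝ × ℝ => ENNReal.ofReal (gaussianPDFReal 0 τ (q.2 - q.1)) := by
    have := measurable_gaussianPDFReal 0 τ
    fun_prop
  ext B hB
  have hshift : ∀ s : ℝ, ∫⁻ z, B.indicator 1 (s + z) ∂gaussianReal 0 τ
      = ∫⁻ x in B, ENNReal.ofReal (gaussianPDFReal 0 τ (x - s)) := fun s => by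
    rw [← lintegral_map (f := B.indicator 1) (measurable_one.indicator hB) (measurable_const_add s),
      gaussianReal_map_const_add, lintegral_indicator_one hB, gaussianReal_apply _ hτ.ne', zero_add]
    simp only [gaussianPDF, gaussianPDFReal, sub_zero]
  rw [withDensity_apply _ hB, ← lintegral_indicator_one hB,
    Measure.lintegral_conv (by measurability)]
  simp_rw [hshift]
  rw [lintegral_lintegral_swap hmeas.aemeasurable]
  refine lintegral_congr fun x => ?_
  rw [gaussianConvPDF, convMeasure, ofReal_integral_eq_lintegral_ofReal
    (integrable_gaussianPDFReal_const_sub x)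
    (Eventually.of_forall fun _ => gaussianPDFReal_nonneg _ _ _)]

theorem le_gaussianConvPDF (hτ : 0 < τ) (hμ : Integrable (fun s => s ^ 2) μ) (x : ℝ) :
    gaussianPDFReal 0 τ 0 * Real.exp (-(x ^ 2 / τ)) * Real.exp (-((∫ s, s ^ 2 ∂μ) / τ))
      ≤ gaussianConvPDF τ μ x := by
  have hφ₀ := gaussianPDFReal_nonneg 0 τ 0
  have hexp : Integrable (fun s => Real.exp (-(s ^ 2 / τ))) μ :=
    integrable_exp_neg (by fun_prop) fun s => by positivity
  calc _ ≤ gaussianPDFReal 0 τ 0 * Real.exp (-(x ^ 2 / τ)) * ∫ s, Real.exp (-(s ^ 2 / τ)) ∂μ := by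
        gcongr
        rw [← integral_div]
        exact exp_neg_integral_le (hμ.div_const _) fun s => by positivity
    _ = ∫ s, gaussianPDFReal 0 τ 0 * Real.exp (-(x ^ 2 / τ)) * Real.exp (-(s ^ 2 / τ)) ∂μ :=
        (integral_const_mul _ _).symm
    _ ≤ gaussianConvPDF τ μ x := integral_mono (hexp.const_mul _)
        (integrable_gaussianPDFReal_const_sub x) fun s => gaussianPDFReal_sub_ge hτ x s

theorem gaussianConvPDF_pos (hτ : 0 < τ) (hμ : Integrable (fun s => s ^ 2) μ) (x : ℝ) :
    0 < gaussianConvPDF τ μ x := by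
  have hφ₀ := gaussianPDFReal_pos 0 τ 0 hτ.ne'
  exact lt_of_lt_of_le (by positivity) (le_gaussianConvPDF hτ hμ x)

/-- The constant `C` in the bound `|ρ(x)| ≤ C (1 + |x|)` for the score `ρ` of `μ ∗ N(0, τ)`, where
`K` bounds the second moment of `μ`. -/
noncomputable def scoreGrowth (τ : ℝ≥0) (K : ℝ) : ℝ := 2 / τ + (1 + 4 * τ) / τ * Real.exp (K / τ)

theorem scoreGrowth_pos (hτ : 0 < τ) (K : ℝ) : 0 < scoreGrowth τ K := by
  rw [scoreGrowth]
  positivity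

theorem abs_convMeasure_gaussianPDFDeriv_le (hτ : 0 < τ) (x : ℝ) :
    |convMeasure (gaussianPDFDeriv τ) μ x| ≤ 2 * |x| / τ * gaussianConvPDF τ μ x
      + (1 + 4 * τ) / τ * (gaussianPDFReal 0 τ 0 * Real.exp (-(x ^ 2 / τ))) := by
  have hint := (integrable_gaussianPDFReal_const_sub (τ := τ) (μ := μ) x).const_mul (2 * |x| / τ)
  set c := (1 + 4 * τ) / τ * (gaussianPDFReal 0 τ 0 * Real.exp (-(x ^ 2 / τ)))
  have hbound : Integrable (fun s => 2 * |x| / τ * gaussianPDFReal 0 τ (x - s) + c) μ :=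
    hint.add (integrable_const c)
  refine (norm_integral_le_of_norm_le (f := fun s => gaussianPDFDeriv τ (x - s)) hbound
    (Eventually.of_forall fun s => abs_gaussianPDFDeriv_le_add hτ x (x - s))).trans_eq ?_
  rw [integral_add hint (integrable_const c), integral_const_mul, integral_const, probReal_univ,
    one_smul, gaussianConvPDF, convMeasure]

theorem abs_logDeriv_gaussianConvPDF_le (hτ : 0 < τ) {K : ℝ}
    (hμ : Integrable (fun s => s ^ 2) μ) (hK : ∫ s, s ^ 2 ∂μ ≤ K) (x : ℝ) :
    |logDeriv (gaussianConvPDF τ μ) x| ≤ scoreGrowth τ K * (1 + |x|) := by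
  have hpos := gaussianConvPDF_pos hτ hμ x
  have hφ₀ := gaussianPDFReal_nonneg 0 τ 0
  set f := gaussianConvPDF τ μ x
  have hlower : gaussianPDFReal 0 τ 0 * Real.exp (-(x ^ 2 / τ)) ≤ Real.exp (K / τ) * f := by
    rw [← div_le_iff₀' (Real.exp_pos _), div_eq_mul_inv, ← Real.exp_neg]
    refine le_trans ?_ (le_gaussianConvPDF hτ hμ x)
    gcongr
  have hbound : |logDeriv (gaussianConvPDF τ μ) x|
      ≤ 2 * |x| / τ + (1 + 4 * τ) / τ * Real.exp (K / τ) := by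
    rw [logDeriv_gaussianConvPDF hτ, abs_div, abs_of_pos hpos, div_le_iff₀ hpos]
    calc _ ≤ 2 * |x| / τ * f
          + (1 + 4 * τ) / τ * (gaussianPDFReal 0 τ 0 * Real.exp (-(x ^ 2 / τ))) :=
          abs_convMeasure_gaussianPDFDeriv_le hτ x
      _ ≤ 2 * |x| / τ * f + (1 + 4 * τ) / τ * (Real.exp (K / τ) * f) := by gcongr
      _ = _ := by ring
  refine hbound.trans (sub_nonneg.1 ?_)
  have hrest : 0 ≤ 2 / (τ : ℝ) + (1 + 4 * τ) / τ * Real.exp (K / τ) * |x| := by positivity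
  exact hrest.trans_eq (by rw [scoreGrowth]; ring)

theorem abs_div_sub_div_le {p p' q q' m A B C : ℝ} (hm : 0 < m) (hq : m ≤ q) (hq' : 0 < q')
    (hp : |p - p'| ≤ A) (hdiff : |q - q'| ≤ B) (hratio : |p' / q'| ≤ C) :
    |p / q - p' / q'| ≤ (A + C * B) / m := by
  have hq0 : 0 < q := hm.trans_le hq
  have hid : p / q - p' / q' = ((p - p') - p' / q' * (q - q')) / q := by
    field_simp
    ring
  have hA : 0 ≤ A := (abs_nonneg _).trans hp
  have hB : 0 ≤ B := (abs_nonneg _).trans hdiff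
  have hC : 0 ≤ C := (abs_nonneg _).trans hratio
  rw [hid, abs_div, abs_of_pos hq0]
  refine div_le_div₀ (by positivity) ((abs_sub _ _).trans ?_) hm hq
  rw [abs_mul]
  gcongr

theorem exists_lipschitzOnWith_logDeriv_gaussianConvPDF (hτ : 0 < τ) (K R : ℝ) :
    ∃ L : ℝ≥0, ∀ (μ : Measure ℝ) [IsProbabilityMeasure μ], Integrable (fun s => s ^ 2) μ →
      ∫ s, s ^ 2 ∂μ ≤ K →
      LipschitzOnWith L (logDeriv (gaussianConvPDF τ μ)) (Set.Icc (-R) R) := by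
  obtain ⟨L', hL'⟩ := exists_lipschitzWith_gaussianPDFDeriv hτ
  have hφ₀ := gaussianPDFReal_pos 0 τ 0 hτ.ne'
  set B := (1 + 2 * τ) / τ * gaussianPDFReal 0 τ 0
  set m := gaussianPDFReal 0 τ 0 * Real.exp (-(R ^ 2 / τ)) * Real.exp (-(K / τ))
  set C := scoreGrowth τ K * (1 + |R|)
  have hC : 0 ≤ C := mul_nonneg (scoreGrowth_pos hτ K).le (by positivity)
  refine ⟨((L' + C * B) / m).toNNReal, fun μ _ hμ hK => .of_dist_le_mul fun x hx y hy => ?_⟩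
  have hm : m ≤ gaussianConvPDF τ μ x := by
    refine le_trans ?_ (le_gaussianConvPDF hτ hμ x)
    gcongr ?_ * Real.exp (-(?_ / _)) * Real.exp (-(?_ / _))
    exact sq_le_sq' hx.1 hx.2
  have hnum : |convMeasure (gaussianPDFDeriv τ) μ x - convMeasure (gaussianPDFDeriv τ) μ y|
      ≤ L' * dist x y :=
    (lipschitzWith_convMeasure (abs_gaussianPDFDeriv_le hτ) hL').dist_le_mul x y
  have hden : |gaussianConvPDF τ μ x - gaussianConvPDF τ μ y| ≤ B * dist x y :=
    convex_univ.norm_image_sub_le_of_norm_hasDerivWithin_le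
      (fun z _ => (hasDerivAt_gaussianConvPDF hτ z).hasDerivWithinAt)
      (fun z _ => abs_convMeasure_le (abs_gaussianPDFDeriv_le hτ) z) (Set.mem_univ y)
      (Set.mem_univ x)
  have hscore := abs_logDeriv_gaussianConvPDF_le hτ hμ hK y
  have hyR : |y| ≤ |R| := (abs_le.2 hy).trans (le_abs_self R)
  have hratio : |convMeasure (gaussianPDFDeriv τ) μ y / gaussianConvPDF τ μ y| ≤ C := by
    rw [← logDeriv_gaussianConvPDF hτ]
    exact hscore.trans (mul_le_mul_of_nonneg_left (by gcongr) (scoreGrowth_pos hτ K).le)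
  rw [Real.coe_toNNReal _ (by positivity), Real.dist_eq, logDeriv_gaussianConvPDF hτ,
    logDeriv_gaussianConvPDF hτ]
  exact (abs_div_sub_div_le (by positivity) hm (gaussianConvPDF_pos hτ hμ y) hnum hden
    hratio).trans_eq (by ring)

end GaussianConv

section GaussianPerturbation

variable {Ω : Type*} [MeasurableSpace Ω] {P : Measure Ω} {A Z : Ω → ℝ} {τ : ℝ≥0}

theorem memLp_two_of_hasLaw_gaussianReal (hZ : HasLaw Z (gaussianReal 0 τ) P) : MemLp Z 2 P := by
  have h := memLp_id_gaussianReal (μ := 0) (v := τ) 2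
  rw [← hZ.map_eq] at h
  exact (memLp_map_measure_iff (by fun_prop) hZ.aemeasurable).1 h

variable [IsProbabilityMeasure P]

theorem isSmoothDensity_add_gaussian (hτ : 0 < τ) (hA : AEMeasurable A P)
    (hZ : HasLaw Z (gaussianReal 0 τ) P) (hAZ : IndepFun A Z P) :
    IsSmoothDensity (P.map (A + Z)) (gaussianConvPDF τ (P.map A)) := by
  have := Measure.isProbabilityMeasure_map hA
  rw [hAZ.map_add_eq_map_conv_map₀ hA hZ.aemeasurable, hZ.map_eq]
  exact isSmoothDensity_gaussianConvPDF hτ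

theorem hasSmoothDensity_add_gaussian (hτ : 0 < τ) (hA : AEMeasurable A P)
    (hZ : HasLaw Z (gaussianReal 0 τ) P) (hAZ : IndepFun A Z P) : HasSmoothDensity (A + Z) P :=
  ⟨_, isSmoothDensity_add_gaussian hτ hA hZ hAZ⟩

theorem abs_score_add_gaussian_le (hτ : 0 < τ) (hA : MemLp A 2 P)
    (hZ : HasLaw Z (gaussianReal 0 τ) P) (hAZ : IndepFun A Z P) {K : ℝ}
    (hK : ∫ ω, A ω ^ 2 ∂P ≤ K) (x : ℝ) :
    |score (A + Z) P x| ≤ scoreGrowth τ K * (1 + |x|) := by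
  have hAm := hA.aemeasurable
  have := Measure.isProbabilityMeasure_map hAm
  have := Measure.isProbabilityMeasure_map (hAm.add hZ.aemeasurable)
  rw [(isSmoothDensity_add_gaussian hτ hAm hZ hAZ).score_eq]
  exact abs_logDeriv_gaussianConvPDF_le hτ
    ((integrable_map_measure (by fun_prop) hAm).2 hA.integrable_sq)
    ((integral_map hAm (by fun_prop)).trans_le hK) x

theorem exists_lipschitzOnWith_score_add_gaussian (hτ : 0 < τ) (K R : ℝ) :
    ∃ L : ℝ≥0, ∀ {Ω : Type*} [MeasurableSpace Ω] {P : Measure Ω} [IsProbabilityMeasure P]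
      {A Z : Ω → ℝ}, MemLp A 2 P → HasLaw Z (gaussianReal 0 τ) P → IndepFun A Z P →
      ∫ ω, A ω ^ 2 ∂P ≤ K → LipschitzOnWith L (score (A + Z) P) (Set.Icc (-R) R) := by
  obtain ⟨L, hL⟩ := exists_lipschitzOnWith_logDeriv_gaussianConvPDF hτ K R
  refine ⟨L, fun {Ω} _ P _ A Z hA hZ hAZ hK => ?_⟩
  have hAm := hA.aemeasurable
  have := Measure.isProbabilityMeasure_map hAm
  rw [(isSmoothDensity_add_gaussian hτ hAm hZ hAZ).score_eq]
  exact hL _ ((integrable_map_measure (by fun_prop) hAm).2 hA.integrable_sq)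
    ((integral_map hAm (by fun_prop)).trans_le hK)

theorem continuous_score_add_gaussian (hτ : 0 < τ) (hA : MemLp A 2 P)
    (hZ : HasLaw Z (gaussianReal 0 τ) P) (hAZ : IndepFun A Z P) :
    Continuous (score (A + Z) P) := by
  have hAm := hA.aemeasurable
  have := Measure.isProbabilityMeasure_map hAm
  have hdens := isSmoothDensity_add_gaussian hτ hAm hZ hAZ
  rw [hdens.score_eq]
  exact (hdens.1.continuous_deriv le_rfl).div hdens.1.continuous fun x =>
    (gaussianConvPDF_pos hτ ((integrable_map_measure (by fun_prop) hAm).2 hA.integrable_sq) x).ne'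

theorem memLp_score_add_gaussian (hτ : 0 < τ) (hA : MemLp A 2 P)
    (hZ : HasLaw Z (gaussianReal 0 τ) P) (hAZ : IndepFun A Z P) :
    MemLp (fun ω => score (A + Z) P ((A + Z) ω)) 2 P := by
  have hAZ2 : MemLp (A + Z) 2 P := hA.add (memLp_two_of_hasLaw_gaussianReal hZ)
  have hbound : MemLp (fun ω => scoreGrowth τ (∫ ω, A ω ^ 2 ∂P) * (1 + |(A + Z) ω|)) 2 P :=
    ((memLp_const (1 : ℝ)).add hAZ2.abs).const_mul _
  refine hbound.mono ((continuous_score_add_gaussian hτ hA hZ hAZ).comp_aestronglyMeasurable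
    hAZ2.aestronglyMeasurable) (Eventually.of_forall fun ω => ?_)
  exact (abs_score_add_gaussian_le hτ hA hZ hAZ le_rfl _).trans (le_abs_self _)

end GaussianPerturbation

section UlamStability

theorem abs_le_of_almost_additive {g : ℝ → ℝ} {R δ : ℝ} (hg : ContinuousOn g (Set.Icc (-R) R))
    (hR : 0 ≤ R) (hgR : g R = 0)
    (hadd : ∀ s r, |s| ≤ R → |r| ≤ R → |g (s + r) - g s - g r| ≤ δ) {x : ℝ} (hx : |x| ≤ R) :
    |g x| ≤ 3 * δ := by
  obtain ⟨x₀, hx₀, hmax⟩ := isCompact_Icc.exists_isMaxOn ⟨0, by simpa using hR⟩ hg.abs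
  have hle : ∀ y, |y| ≤ R → |g y| ≤ |g x₀| := fun y hy => hmax (abs_le.1 hy)
  have hhalf : ∀ y, |y| ≤ R / 2 → 2 * |g y| ≤ |g x₀| + δ := fun y hy => by
    have hdouble := hadd y y (by linarith) (by linarith)
    have hmax_double := hle (y + y) (by rw [← two_mul, abs_mul, abs_two]; linarith)
    calc 2 * |g y| = |g (y + y) - (g (y + y) - g y - g y)| := by
          rw [show g (y + y) - (g (y + y) - g y - g y) = 2 * g y by ring, abs_mul, abs_two]
      _ ≤ |g x₀| + δ := (abs_sub _ _).trans (add_le_add hmax_double hdouble)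
  -- A point of the outer half is moved into the inner half by `± R`, at the cost of one `δ`.
  have hfull : ∀ y, |y| ≤ R → 2 * |g y| ≤ |g x₀| + 3 * δ := fun y hy => by
    have hRR : |R| ≤ R := (abs_of_nonneg hR).le
    have hδ : 0 ≤ δ := (abs_nonneg _).trans (hadd R R hRR hRR)
    rcases le_total |y| (R / 2) with hin | hout
    · linarith [hhalf y hin]
    obtain ⟨hy_lower, hy_upper⟩ := abs_le.1 hy
    rcases le_total 0 y with hpos | hneg
    · rw [abs_of_nonneg hpos] at hout
      have hshift : |y - R| ≤ R / 2 := abs_le.2 ⟨by linarith, by linarith⟩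
      have hclose := hadd (y - R) R (by linarith) hRR
      rw [sub_add_cancel, hgR, sub_zero] at hclose
      linarith [hhalf _ hshift, abs_sub_abs_le_abs_sub (g y) (g (y - R))]
    · rw [abs_of_nonpos hneg] at hout
      have hshift : |y + R| ≤ R / 2 := abs_le.2 ⟨by linarith, by linarith⟩
      have hclose := hadd y R hy hRR
      rw [hgR, sub_zero, abs_sub_comm] at hclose
      linarith [hhalf _ hshift, abs_sub_abs_le_abs_sub (g y) (g (y + R))]
  linarith [hfull x₀ (abs_le.2 hx₀), hle x hx]

theorem abs_sub_linear_le_of_almost_additive {f : ℝ → ℝ} {R δ : ℝ}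
    (hf : ContinuousOn f (Set.Icc (-R) R)) (hR : 0 < R)
    (hadd : ∀ s r, |s| ≤ R → |r| ≤ R → |f (s + r) - f s - f r| ≤ δ) {x : ℝ} (hx : |x| ≤ R) :
    |f x - f R / R * x| ≤ 3 * δ := by
  refine abs_le_of_almost_additive (g := fun x => f x - f R / R * x) (by fun_prop) hR.le
    (by simp [hR.ne']) (fun s r hs hr => ?_) hx
  convert hadd s r hs hr using 2
  ring

theorem abs_add_sub_sub_le_of_functional_eq {F G k : ℝ → ℝ} {a b b₀ R δ : ℝ} (hb₀ : 0 < b₀)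
    (ha : b₀ ≤ a) (hb : b₀ ≤ b) (ha1 : a ≤ 1)
    (h : ∀ x y, |x| ≤ 2 * R + R / b₀ → |y| ≤ 2 * R + R / b₀ →
      |a * F x + b * G y - k (a * x + b * y)| ≤ δ) {s r : ℝ} (hs : |s| ≤ R) (hr : |r| ≤ R) :
    |F (s + r) - F s - F r + F 0| ≤ 4 * δ / b₀ := by
  have ha0 : 0 < a := hb₀.trans_le ha
  have hb0 : 0 < b := hb₀.trans_le hb
  have hR : 0 ≤ R := (abs_nonneg _).trans hs
  have hRb : 0 ≤ R / b₀ := by positivity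
  -- With `a r + b y = 0`, the unknown `k` takes equal values at `(s + r, y)` and `(s, 0)`, and at
  -- `(r, y)` and `(0, 0)`, so that it cancels.
  set y := -(a * r / b)
  have hy : |y| ≤ 2 * R + R / b₀ := by
    have : |y| ≤ R / b₀ := by
      rw [abs_neg, abs_div, abs_mul, abs_of_pos ha0, abs_of_pos hb0]
      exact div_le_div₀ hR ((mul_le_of_le_one_left (abs_nonneg r) ha1).trans hr) hb₀ hb
    linarith
  have hby : b * y = -(a * r) := by
    simp only [y]
    field_simp
  have hdefect_sr := h (s + r) y (by linarith [abs_add_le s r]) hy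
  have hdefect_s := h s 0 (by linarith) (by rw [abs_zero]; linarith)
  have hdefect_r := h r y (by linarith) hy
  have hdefect_0 := h 0 0 (by rw [abs_zero]; linarith) (by rw [abs_zero]; linarith)
  rw [show a * (s + r) + b * y = a * s + b * 0 by rw [hby]; ring] at hdefect_sr
  rw [show a * r + b * y = a * 0 + b * 0 by rw [hby]; ring] at hdefect_r
  rw [abs_le] at hdefect_sr hdefect_s hdefect_r hdefect_0
  rw [le_div_iff₀ hb₀]
  calc |F (s + r) - F s - F r + F 0| * b₀ ≤ |F (s + r) - F s - F r + F 0| * a := by gcongr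
    _ = |a * (F (s + r) - F s - F r + F 0)| := by rw [abs_mul, abs_of_pos ha0, mul_comm]
    _ ≤ 4 * δ := abs_le.2 ⟨by linarith, by linarith⟩

theorem exists_affine_approx_of_functional_eq {F G k : ℝ → ℝ} (hF : Continuous F)
    {a b b₀ R δ : ℝ} (hb₀ : 0 < b₀) (ha : b₀ ≤ a) (hb : b₀ ≤ b) (ha1 : a ≤ 1) (hR : 0 < R)
    (h : ∀ x y, |x| ≤ 2 * R + R / b₀ → |y| ≤ 2 * R + R / b₀ →
      |a * F x + b * G y - k (a * x + b * y)| ≤ δ) :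
    ∃ A B : ℝ, ∀ x, |x| ≤ R → |F x - (A + B * x)| ≤ 12 * δ / b₀ := by
  refine ⟨F 0, (F R - F 0) / R, fun x hx => ?_⟩
  have hlin := abs_sub_linear_le_of_almost_additive (f := fun x => F x - F 0) (by fun_prop) hR
    (fun s r hs hr => (congrArg abs (by ring)).trans_le
      (abs_add_sub_sub_le_of_functional_eq hb₀ ha hb ha1 h hs hr)) hx
  calc |F x - (F 0 + (F R - F 0) / R * x)| = |F x - F 0 - (F R - F 0) / R * x| := by rw [sub_sub]
    _ ≤ 3 * (4 * δ / b₀) := hlin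
    _ = 12 * δ / b₀ := by ring

end UlamStability

section Pair

theorem mix_add {Ω : Type*} (X Y X' Y' : Ω → ℝ) (β : ℝ) :
    mix (X + X') (Y + Y') β = mix X Y β + mix X' Y' β := by
  ext ω
  simp only [mix, Pi.add_apply]
  ring

theorem sq_mix_le {Ω : Type*} {X Y : Ω → ℝ} {β : ℝ} (hβ : β ∈ Set.Icc (0 : ℝ) 1) (ω : Ω) :
    mix X Y β ω ^ 2 ≤ X ω ^ 2 + Y ω ^ 2 := by
  have hlagrange : (√β ^ 2 + √(1 - β) ^ 2) * (X ω ^ 2 + Y ω ^ 2)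
      = mix X Y β ω ^ 2 + (√β * Y ω - √(1 - β) * X ω) ^ 2 := by
    rw [mix]
    ring
  rw [Real.sq_sqrt hβ.1, Real.sq_sqrt (sub_nonneg.2 hβ.2), add_sub_cancel, one_mul] at hlagrange
  linarith [sq_nonneg (√β * Y ω - √(1 - β) * X ω)]

variable {Ω : Type*} [MeasurableSpace Ω] {P : Measure Ω} {S T ZS ZT : Ω → ℝ} {τ : ℝ≥0} {β : ℝ}

theorem memLp_mix {X Y : Ω → ℝ} {p : ℝ≥0∞} (hX : MemLp X p P) (hY : MemLp Y p P) (β : ℝ) :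
    MemLp (mix X Y β) p P :=
  (hX.const_mul √β).add (hY.const_mul √(1 - β))

theorem integral_mix_sq_le {X Y : Ω → ℝ} (hX : MemLp X 2 P) (hY : MemLp Y 2 P)
    (hβ : β ∈ Set.Icc (0 : ℝ) 1) :
    ∫ ω, mix X Y β ω ^ 2 ∂P ≤ ∫ ω, X ω ^ 2 ∂P + ∫ ω, Y ω ^ 2 ∂P := by
  rw [← integral_add hX.integrable_sq hY.integrable_sq]
  exact integral_mono (memLp_mix hX hY β).integrable_sq (hX.integrable_sq.add hY.integrable_sq)
    (sq_mix_le hβ)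

namespace IsGaussianPerturbation

theorem indepFun_left (hN : IsGaussianPerturbation S T ZS ZT τ P) : IndepFun S ZS P :=
  hN.indep.comp measurable_fst measurable_fst

theorem indepFun_right (hN : IsGaussianPerturbation S T ZS ZT τ P) : IndepFun T ZT P :=
  hN.indep.comp measurable_snd measurable_snd

theorem indepFun_mix (hN : IsGaussianPerturbation S T ZS ZT τ P) (β : ℝ) :
    IndepFun (mix S T β) (mix ZS ZT β) P :=
  hN.indep.comp (φ := fun q : ℝ × ℝ => √β * q.1 + √(1 - β) * q.2)
    (ψ := fun q : ℝ × ℝ => √β * q.1 + √(1 - β) * q.2) (by fun_prop) (by fun_prop)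

theorem hasLaw_mix (hN : IsGaussianPerturbation S T ZS ZT τ P) (hβ : β ∈ Set.Icc (0 : ℝ) 1) :
    HasLaw (mix ZS ZT β) (gaussianReal 0 τ) P := by
  have hleft := gaussianReal_const_mul hN.law_left √β
  have hright := gaussianReal_const_mul hN.law_right √(1 - β)
  have hindep : IndepFun (fun ω => √β * ZS ω) (fun ω => √(1 - β) * ZT ω) P :=
    hN.indep_noise.comp (φ := fun z => √β * z) (ψ := fun z => √(1 - β) * z)
      (by fun_prop) (by fun_prop)
  have hvar : (NNReal.mk (√β ^ 2) (sq_nonneg _) * τ + NNReal.mk (√(1 - β) ^ 2) (sq_nonneg _) * τ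
      : ℝ≥0) = τ := by
    rw [← add_mul]
    convert one_mul τ
    ext
    push_cast
    rw [Real.sq_sqrt hβ.1, Real.sq_sqrt (sub_nonneg.2 hβ.2), add_sub_cancel]
  refine ⟨hleft.aemeasurable.add hright.aemeasurable, ?_⟩
  have hsum := gaussianReal_add_gaussianReal_of_indepFun hindep hleft.map_eq hright.map_eq
  rwa [hvar, mul_zero, mul_zero, add_zero] at hsum

theorem hasSmoothDensity_mix [IsProbabilityMeasure P] (hN : IsGaussianPerturbation S T ZS ZT τ P)
    (hτ : 0 < τ) (hS : AEMeasurable S P) (hT : AEMeasurable T P) (hβ : β ∈ Set.Icc (0 : ℝ) 1) :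
    HasSmoothDensity (mix (S + ZS) (T + ZT) β) P := by
  rw [mix_add]
  exact hasSmoothDensity_add_gaussian hτ ((hS.const_mul _).add (hT.const_mul _))
    (hN.hasLaw_mix hβ) (hN.indepFun_mix β)

theorem memLp_scoreDefect [IsProbabilityMeasure P] (hN : IsGaussianPerturbation S T ZS ZT τ P)
    (hτ : 0 < τ) (hS : MemLp S 2 P) (hT : MemLp T 2 P) (hβ : β ∈ Set.Icc (0 : ℝ) 1) :
    MemLp (scoreDefect (S + ZS) (T + ZT) β P) 2 P := by
  have hmix := memLp_score_add_gaussian hτ (memLp_mix hS hT β) (hN.hasLaw_mix hβ)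
    (hN.indepFun_mix β)
  rw [← mix_add] at hmix
  exact (memLp_mix (memLp_score_add_gaussian hτ hS hN.law_left hN.indepFun_left)
    (memLp_score_add_gaussian hτ hT hN.law_right hN.indepFun_right) β).sub hmix

theorem measure_add_mem_and_add_mem [IsFiniteMeasure P]
    (hN : IsGaussianPerturbation S T ZS ZT τ P) (hS : AEMeasurable S P) (hT : AEMeasurable T P)
    {A B : Set ℝ} (hA : MeasurableSet A) (hB : MeasurableSet B) :
    P {ω | S ω + ZS ω ∈ A ∧ T ω + ZT ω ∈ B}
      = ∫⁻ ω, gaussianReal (S ω) τ A * gaussianReal (T ω) τ B ∂P := by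
  have hZS := hN.law_left.aemeasurable
  have hZT := hN.law_right.aemeasurable
  have hjoint : P.map (fun ω => ((S ω, T ω), (ZS ω, ZT ω)))
      = (P.map fun ω => (S ω, T ω)).prod ((gaussianReal 0 τ).prod (gaussianReal 0 τ)) := by
    rw [(indepFun_iff_map_prod_eq_prod_map_map (hS.prodMk hT) (hZS.prodMk hZT)).1 hN.indep,
      (indepFun_iff_map_prod_eq_prod_map_map hZS hZT).1 hN.indep_noise, hN.law_left.map_eq,
      hN.law_right.map_eq]
  set D : Set ((ℝ × ℝ) × (ℝ × ℝ)) := {q | q.1.1 + q.2.1 ∈ A ∧ q.1.2 + q.2.2 ∈ B}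
  have hD : MeasurableSet D :=
    (hA.preimage (f := fun q : (ℝ × ℝ) × (ℝ × ℝ) => q.1.1 + q.2.1) (by fun_prop)).inter
      (hB.preimage (f := fun q : (ℝ × ℝ) × (ℝ × ℝ) => q.1.2 + q.2.2) (by fun_prop))
  have hfiber : ∀ s t : ℝ, (gaussianReal 0 τ).prod (gaussianReal 0 τ) (Prod.mk (s, t) ⁻¹' D)
      = gaussianReal s τ A * gaussianReal t τ B := fun s t => by
    have hshift (u : ℝ) : gaussianReal u τ = (gaussianReal 0 τ).map (u + ·) := by
      rw [gaussianReal_map_const_add, zero_add]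
    rw [hshift s, hshift t, Measure.map_apply (by fun_prop) hA, Measure.map_apply (by fun_prop) hB,
      ← Measure.prod_prod]
    rfl
  calc P {ω | S ω + ZS ω ∈ A ∧ T ω + ZT ω ∈ B}
      = P.map (fun ω => ((S ω, T ω), (ZS ω, ZT ω))) D :=
        (Measure.map_apply_of_aemeasurable ((hS.prodMk hT).prodMk (hZS.prodMk hZT)) hD).symm
    _ = ∫⁻ ω, gaussianReal (S ω) τ A * gaussianReal (T ω) τ B ∂P := by
        rw [hjoint, Measure.prod_apply hD,
          lintegral_map' (measurable_measure_prodMk_left hD).aemeasurable (hS.prodMk hT)]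
        exact lintegral_congr fun ω => hfiber (S ω) (T ω)

end IsGaussianPerturbation

theorem le_gaussianReal_of_subset_Icc (hτ : 0 < τ) {A : Set ℝ} (hA : MeasurableSet A) {R : ℝ}
    (hAR : A ⊆ Set.Icc (-R) R) (s : ℝ) :
    ENNReal.ofReal (gaussianPDFReal 0 τ 0 * Real.exp (-(R ^ 2 / τ)) * Real.exp (-(s ^ 2 / τ)))
      * volume A ≤ gaussianReal s τ A := by
  have hφ₀ := gaussianPDFReal_nonneg 0 τ 0
  rw [gaussianReal_apply _ hτ.ne', ← setLIntegral_const]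
  refine setLIntegral_mono' hA fun x hx => ENNReal.ofReal_le_ofReal ?_
  calc gaussianPDFReal 0 τ 0 * Real.exp (-(R ^ 2 / τ)) * Real.exp (-(s ^ 2 / τ))
      ≤ gaussianPDFReal 0 τ 0 * Real.exp (-(x ^ 2 / τ)) * Real.exp (-(s ^ 2 / τ)) := by
        gcongr _ * Real.exp (-(?_ / _)) * _
        exact sq_le_sq' (hAR hx).1 (hAR hx).2
    _ ≤ gaussianPDFReal 0 τ (x - s) := gaussianPDFReal_sub_ge hτ x s
    _ = gaussianPDFReal s τ x := by simp [gaussianPDFReal]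

/-- A lower bound on the box `[-R, R]²` for the joint density of `(S + Z_S, T + Z_T)`, where `K`
bounds `E S² + E T²`. -/
noncomputable def jointDensityBound (τ : ℝ≥0) (K R : ℝ) : ℝ :=
  (gaussianPDFReal 0 τ 0 * Real.exp (-(R ^ 2 / τ))) ^ 2 * Real.exp (-(K / τ))

theorem jointDensityBound_pos (hτ : 0 < τ) (K R : ℝ) : 0 < jointDensityBound τ K R := by
  have hφ₀ := gaussianPDFReal_pos 0 τ 0 hτ.ne'
  rw [jointDensityBound]
  positivity

variable [IsProbabilityMeasure P] {K : ℝ}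

theorem ofReal_jointDensityBound_le_lintegral (hS : MemLp S 2 P) (hT : MemLp T 2 P)
    (hK : ∫ ω, S ω ^ 2 ∂P + ∫ ω, T ω ^ 2 ∂P ≤ K) (R : ℝ) :
    ENNReal.ofReal (jointDensityBound τ K R)
      ≤ ∫⁻ ω, ENNReal.ofReal
            (gaussianPDFReal 0 τ 0 * Real.exp (-(R ^ 2 / τ)) * Real.exp (-(S ω ^ 2 / τ)))
          * ENNReal.ofReal
            (gaussianPDFReal 0 τ 0 * Real.exp (-(R ^ 2 / τ)) * Real.exp (-(T ω ^ 2 / τ))) ∂P := by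
  have hφ₀ := gaussianPDFReal_nonneg 0 τ 0
  set m := gaussianPDFReal 0 τ 0 * Real.exp (-(R ^ 2 / τ))
  have : 0 ≤ m := by positivity
  have hint : Integrable (fun ω => (S ω ^ 2 + T ω ^ 2) / τ) P :=
    (hS.integrable_sq.add hT.integrable_sq).div_const _
  have hjensen : Real.exp (-(K / τ)) ≤ ∫ ω, Real.exp (-((S ω ^ 2 + T ω ^ 2) / τ)) ∂P := by
    refine le_trans ?_ (exp_neg_integral_le hint fun ω => by positivity)
    rw [integral_div, integral_add hS.integrable_sq hT.integrable_sq]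
    gcongr
  calc ENNReal.ofReal (jointDensityBound τ K R)
      ≤ ENNReal.ofReal (∫ ω, m ^ 2 * Real.exp (-((S ω ^ 2 + T ω ^ 2) / τ)) ∂P) := by
        rw [integral_const_mul]
        exact ENNReal.ofReal_le_ofReal (mul_le_mul_of_nonneg_left hjensen (sq_nonneg m))
    _ = ∫⁻ ω, ENNReal.ofReal (m ^ 2 * Real.exp (-((S ω ^ 2 + T ω ^ 2) / τ))) ∂P :=
        ofReal_integral_eq_lintegral_ofReal
          ((integrable_exp_neg hint.1 fun ω => by positivity).const_mul _)
          (Eventually.of_forall fun ω => by positivity)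
    _ = _ := lintegral_congr fun ω => by
        rw [← ENNReal.ofReal_mul (by positivity), add_div, neg_add, Real.exp_add]
        ring_nf

namespace IsGaussianPerturbation

theorem le_measure_add_mem_and_add_mem (hN : IsGaussianPerturbation S T ZS ZT τ P) (hτ : 0 < τ)
    (hS : MemLp S 2 P) (hT : MemLp T 2 P) (hK : ∫ ω, S ω ^ 2 ∂P + ∫ ω, T ω ^ 2 ∂P ≤ K) {R : ℝ}
    {A B : Set ℝ} (hA : MeasurableSet A) (hB : MeasurableSet B) (hAR : A ⊆ Set.Icc (-R) R)
    (hBR : B ⊆ Set.Icc (-R) R) :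
    ENNReal.ofReal (jointDensityBound τ K R) * (volume A * volume B)
      ≤ P {ω | S ω + ZS ω ∈ A ∧ T ω + ZT ω ∈ B} := by
  rw [hN.measure_add_mem_and_add_mem hS.aemeasurable hT.aemeasurable hA hB]
  refine (mul_le_mul_left (ofReal_jointDensityBound_le_lintegral hS hT hK R) _).trans ?_
  refine (lintegral_mul_const_le _ _).trans (lintegral_mono fun ω => ?_)
  rw [mul_mul_mul_comm]
  exact mul_le_mul' (le_gaussianReal_of_subset_Icc hτ hA hAR (S ω))
    (le_gaussianReal_of_subset_Icc hτ hB hBR (T ω))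

theorem mul_sq_le_measureReal_square (hN : IsGaussianPerturbation S T ZS ZT τ P) (hτ : 0 < τ)
    (hS : MemLp S 2 P) (hT : MemLp T 2 P) (hK : ∫ ω, S ω ^ 2 ∂P + ∫ ω, T ω ^ 2 ∂P ≤ K)
    {R r x y : ℝ} (hr : 0 ≤ r) (hx : Set.Icc x (x + r) ⊆ Set.Icc (-R) R)
    (hy : Set.Icc y (y + r) ⊆ Set.Icc (-R) R) :
    jointDensityBound τ K R * r ^ 2
      ≤ P.real {ω | S ω + ZS ω ∈ Set.Icc x (x + r) ∧ T ω + ZT ω ∈ Set.Icc y (y + r)} := by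
  have hbound := hN.le_measure_add_mem_and_add_mem hτ hS hT hK measurableSet_Icc measurableSet_Icc
    hx hy
  rw [Real.volume_Icc, Real.volume_Icc, add_sub_cancel_left, add_sub_cancel_left,
    ← ENNReal.ofReal_mul hr, ← ENNReal.ofReal_mul (jointDensityBound_pos hτ K R).le, ← sq] at hbound
  exact (ENNReal.ofReal_le_iff_le_toReal (measure_ne_top _ _)).1 hbound

end IsGaussianPerturbation

end Pair

section ScoreDefect

variable {Ω : Type*} [MeasurableSpace Ω] {P : Measure Ω} {X Y : Ω → ℝ} {β : ℝ}

/-- The score defect as a function of the values of `X` and `Y`: `scoreDefect X Y β P ω` is its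
value at `(X ω, Y ω)`. -/
noncomputable def scoreDefectAt (X Y : Ω → ℝ) (β : ℝ) (P : Measure Ω) (q : ℝ × ℝ) : ℝ :=
  √β * score X P q.1 + √(1 - β) * score Y P q.2
    - score (mix X Y β) P (√β * q.1 + √(1 - β) * q.2)

theorem scoreDefect_eq_scoreDefectAt (X Y : Ω → ℝ) (β : ℝ) (P : Measure Ω) (ω : Ω) :
    scoreDefect X Y β P ω = scoreDefectAt X Y β P (X ω, Y ω) :=
  rfl

theorem sq_mul_measureReal_le_Delta [IsFiniteMeasure P] {δ : ℝ} {E : Set Ω}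
    (hD : MemLp (scoreDefect X Y β P) 2 P) (hδ : 0 ≤ δ)
    (hE : ∀ ω ∈ E, δ ≤ |scoreDefect X Y β P ω|) : δ ^ 2 * P.real E ≤ Delta X Y β P := by
  calc δ ^ 2 * P.real E ≤ δ ^ 2 * P.real {ω | δ ^ 2 ≤ scoreDefect X Y β P ω ^ 2} := by
        gcongr
        · exact measure_ne_top _ _
        · exact fun ω hω => (pow_le_pow_left₀ hδ (hE ω hω) 2).trans_eq (sq_abs _)
    _ ≤ Delta X Y β P := mul_meas_ge_le_integral_of_nonneg
        (Eventually.of_forall fun _ => sq_nonneg _) hD.integrable_sq _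

theorem abs_sqrt_mul_add_sqrt_mul_le {β u v B : ℝ} (hβ : β ∈ Set.Icc (0 : ℝ) 1) (hu : |u| ≤ B)
    (hv : |v| ≤ B) : |√β * u + √(1 - β) * v| ≤ 2 * B := by
  have hβ1 : √β ≤ 1 := Real.sqrt_le_one.2 hβ.2
  have hβ2 : √(1 - β) ≤ 1 := Real.sqrt_le_one.2 (sub_le_self 1 hβ.1)
  calc |√β * u + √(1 - β) * v| ≤ √β * |u| + √(1 - β) * |v| := by
        simpa only [abs_mul, abs_of_nonneg (Real.sqrt_nonneg _)]
          using abs_add_le (√β * u) (√(1 - β) * v)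
    _ ≤ 1 * B + 1 * B := by gcongr
    _ = 2 * B := by ring

theorem lipschitzOnWith_scoreDefectAt {L : ℝ≥0} {R : ℝ} (hβ : β ∈ Set.Icc (0 : ℝ) 1)
    (hX : LipschitzOnWith L (score X P) (Set.Icc (-R) R))
    (hY : LipschitzOnWith L (score Y P) (Set.Icc (-R) R))
    (hXY : LipschitzOnWith L (score (mix X Y β) P) (Set.Icc (-(2 * R)) (2 * R))) :
    LipschitzOnWith (4 * L) (scoreDefectAt X Y β P) (Set.Icc (-R) R ×ˢ Set.Icc (-R) R) := by
  refine .of_dist_le_mul fun q hq q' hq' => ?_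
  have hfst : |q.1 - q'.1| ≤ dist q q' := le_max_left (dist q.1 q'.1) (dist q.2 q'.2)
  have hsnd : |q.2 - q'.2| ≤ dist q q' := le_max_right (dist q.1 q'.1) (dist q.2 q'.2)
  have hscoreX : |score X P q.1 - score X P q'.1| ≤ L * dist q q' :=
    (hX.dist_le_mul _ hq.1 _ hq'.1).trans (by gcongr; exact hfst)
  have hscoreY : |score Y P q.2 - score Y P q'.2| ≤ L * dist q q' :=
    (hY.dist_le_mul _ hq.2 _ hq'.2).trans (by gcongr; exact hsnd)
  have hbox {p : ℝ × ℝ} (hp : p ∈ Set.Icc (-R) R ×ˢ Set.Icc (-R) R) :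
      √β * p.1 + √(1 - β) * p.2 ∈ Set.Icc (-(2 * R)) (2 * R) :=
    abs_le.1 (abs_sqrt_mul_add_sqrt_mul_le hβ (abs_le.2 hp.1) (abs_le.2 hp.2))
  have hmix : dist (√β * q.1 + √(1 - β) * q.2) (√β * q'.1 + √(1 - β) * q'.2) ≤ 2 * dist q q' := by
    rw [Real.dist_eq, show √β * q.1 + √(1 - β) * q.2 - (√β * q'.1 + √(1 - β) * q'.2)
      = √β * (q.1 - q'.1) + √(1 - β) * (q.2 - q'.2) by ring]
    exact abs_sqrt_mul_add_sqrt_mul_le hβ hfst hsnd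
  have hscoreXY := (hXY.dist_le_mul _ (hbox hq) _ (hbox hq')).trans
    (mul_le_mul_of_nonneg_left hmix L.coe_nonneg)
  rw [Real.dist_eq] at hscoreXY
  calc |scoreDefectAt X Y β P q - scoreDefectAt X Y β P q'|
      = |(√β * (score X P q.1 - score X P q'.1) + √(1 - β) * (score Y P q.2 - score Y P q'.2))
          - (score (mix X Y β) P (√β * q.1 + √(1 - β) * q.2)
            - score (mix X Y β) P (√β * q'.1 + √(1 - β) * q'.2))| := by
        simp only [scoreDefectAt]
        ring_nf
    _ ≤ 2 * (L * dist q q') + L * (2 * dist q q') := (abs_sub _ _).trans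
        (add_le_add (abs_sqrt_mul_add_sqrt_mul_le hβ hscoreX hscoreY) hscoreXY)
    _ = (4 * L : ℝ≥0) * dist q q' := by
        push_cast
        ring

variable [IsProbabilityMeasure P] {S T ZS ZT : Ω → ℝ} {τ : ℝ≥0} {K : ℝ}

theorem IsGaussianPerturbation.abs_scoreDefectAt_le
    (hN : IsGaussianPerturbation S T ZS ZT τ P) (hτ : 0 < τ) (hS : MemLp S 2 P) (hT : MemLp T 2 P)
    (hK : ∫ ω, S ω ^ 2 ∂P + ∫ ω, T ω ^ 2 ∂P ≤ K) (hβ : β ∈ Set.Icc (0 : ℝ) 1) {L : ℝ≥0}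
    {R r δ x y : ℝ} (hr : 0 ≤ r) (hδ : 0 ≤ δ) (hLr : L * r ≤ δ)
    (hx : Set.Icc x (x + r) ⊆ Set.Icc (-R) R) (hy : Set.Icc y (y + r) ⊆ Set.Icc (-R) R)
    (hL : LipschitzOnWith L (scoreDefectAt (S + ZS) (T + ZT) β P)
      (Set.Icc (-R) R ×ˢ Set.Icc (-R) R))
    (hΔ : Delta (S + ZS) (T + ZT) β P < δ ^ 2 * (jointDensityBound τ K R * r ^ 2)) :
    |scoreDefectAt (S + ZS) (T + ZT) β P (x, y)| ≤ 2 * δ := by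
  by_contra! hlarge
  set E := {ω | S ω + ZS ω ∈ Set.Icc x (x + r) ∧ T ω + ZT ω ∈ Set.Icc y (y + r)}
  have hE : ∀ ω ∈ E, δ ≤ |scoreDefect (S + ZS) (T + ZT) β P ω| := fun ω hω => by
    have hmem : (x, y) ∈ Set.Icc (-R) R ×ˢ Set.Icc (-R) R :=
      ⟨hx ⟨le_rfl, le_add_of_nonneg_right hr⟩, hy ⟨le_rfl, le_add_of_nonneg_right hr⟩⟩
    have hmem' : ((S + ZS) ω, (T + ZT) ω) ∈ Set.Icc (-R) R ×ˢ Set.Icc (-R) R :=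
      ⟨hx hω.1, hy hω.2⟩
    have hclose : dist (x, y) ((S + ZS) ω, (T + ZT) ω) ≤ r := by
      rw [Prod.dist_eq, dist_comm, dist_comm y]
      exact max_le
        (abs_le.2 ⟨(neg_nonpos.2 hr).trans (sub_nonneg.2 hω.1.1), sub_le_iff_le_add'.2 hω.1.2⟩)
        (abs_le.2 ⟨(neg_nonpos.2 hr).trans (sub_nonneg.2 hω.2.1), sub_le_iff_le_add'.2 hω.2.2⟩)
    have hdist := ((hL.dist_le_mul _ hmem _ hmem').trans
      (mul_le_mul_of_nonneg_left hclose L.coe_nonneg)).trans hLr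
    rw [Real.dist_eq, ← scoreDefect_eq_scoreDefectAt] at hdist
    linarith [abs_sub_abs_le_abs_sub (scoreDefectAt (S + ZS) (T + ZT) β P (x, y))
      (scoreDefect (S + ZS) (T + ZT) β P ω)]
  refine hΔ.not_ge (le_trans ?_ (sq_mul_measureReal_le_Delta
    (hN.memLp_scoreDefect hτ hS hT hβ) hδ hE))
  gcongr
  exact hN.mul_sq_le_measureReal_square hτ hS hT hK hr hx hy

theorem exists_lipschitzOnWith_scoreDefectAt (hτ : 0 < τ) (K R : ℝ) :
    ∃ L : ℝ≥0, ∀ {Ω : Type*} [MeasurableSpace Ω] {P : Measure Ω} [IsProbabilityMeasure P]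
      {S T ZS ZT : Ω → ℝ} {β : ℝ}, MemLp S 2 P → MemLp T 2 P →
      ∫ ω, S ω ^ 2 ∂P + ∫ ω, T ω ^ 2 ∂P ≤ K → IsGaussianPerturbation S T ZS ZT τ P →
      β ∈ Set.Icc (0 : ℝ) 1 →
      LipschitzOnWith L (scoreDefectAt (S + ZS) (T + ZT) β P)
        (Set.Icc (-R) R ×ˢ Set.Icc (-R) R) := by
  obtain ⟨L₁, hL₁⟩ := exists_lipschitzOnWith_score_add_gaussian hτ K R
  obtain ⟨L₂, hL₂⟩ := exists_lipschitzOnWith_score_add_gaussian hτ K (2 * R)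
  refine ⟨4 * max L₁ L₂, fun {Ω} _ P _ S T ZS ZT β hS hT hK hN hβ => ?_⟩
  have hS0 : 0 ≤ ∫ ω, S ω ^ 2 ∂P := integral_nonneg fun _ => sq_nonneg _
  have hT0 : 0 ≤ ∫ ω, T ω ^ 2 ∂P := integral_nonneg fun _ => sq_nonneg _
  refine lipschitzOnWith_scoreDefectAt hβ
    ((hL₁ hS hN.law_left hN.indepFun_left (by linarith)).weaken (le_max_left _ _))
    ((hL₁ hT hN.law_right hN.indepFun_right (by linarith)).weaken (le_max_left _ _)) ?_
  rw [mix_add]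
  exact (hL₂ (memLp_mix hS hT β) (hN.hasLaw_mix hβ) (hN.indepFun_mix β)
    ((integral_mix_sq_le hS hT hβ).trans hK)).weaken (le_max_right _ _)

theorem exists_abs_scoreDefectAt_le (hτ : 0 < τ) (K R : ℝ) {δ : ℝ} (hδ : 0 < δ) :
    ∃ ε > 0, ∀ {Ω : Type*} [MeasurableSpace Ω] {P : Measure Ω} [IsProbabilityMeasure P]
      {S T ZS ZT : Ω → ℝ} {β : ℝ}, MemLp S 2 P → MemLp T 2 P →
      ∫ ω, S ω ^ 2 ∂P + ∫ ω, T ω ^ 2 ∂P ≤ K → IsGaussianPerturbation S T ZS ZT τ P →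
      β ∈ Set.Icc (0 : ℝ) 1 → Delta (S + ZS) (T + ZT) β P < ε →
      ∀ x y, |x| ≤ R → |y| ≤ R → |scoreDefectAt (S + ZS) (T + ZT) β P (x, y)| ≤ δ := by
  obtain ⟨L, hL⟩ := exists_lipschitzOnWith_scoreDefectAt hτ K (R + 1)
  obtain ⟨r, hr, hr1, hLr⟩ : ∃ r > 0, r ≤ 1 ∧ L * r ≤ δ / 2 := by
    refine ⟨min 1 (δ / 2 / (L + 1)), by positivity, min_le_left _ _, ?_⟩
    calc L * min 1 (δ / 2 / (L + 1)) ≤ (L + 1) * (δ / 2 / (L + 1)) := by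
          gcongr
          · exact le_add_of_nonneg_right zero_le_one
          · exact min_le_right _ _
      _ = δ / 2 := mul_div_cancel₀ _ (by positivity)
  have hc := jointDensityBound_pos hτ K (R + 1)
  refine ⟨(δ / 2) ^ 2 * (jointDensityBound τ K (R + 1) * r ^ 2), by positivity, ?_⟩
  intro Ω _ P _ S T ZS ZT β hS hT hK hN hβ hΔ x y hx hy
  have hsquare {z : ℝ} (hz : |z| ≤ R) : Set.Icc z (z + r) ⊆ Set.Icc (-(R + 1)) (R + 1) :=
    Set.Icc_subset_Icc (by linarith [neg_le_of_abs_le hz]) (by linarith [le_of_abs_le hz])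
  exact (hN.abs_scoreDefectAt_le hτ hS hT hK hβ hr.le (by positivity) hLr (hsquare hx)
    (hsquare hy) (hL hS hT hK hN hβ) hΔ).trans_eq (mul_div_cancel₀ δ two_ne_zero)

end ScoreDefect

section TailClass

variable {Ω : Type*} [MeasurableSpace Ω] {P : Measure Ω} {ψ : ℝ → ℝ} {U A Z : Ω → ℝ} {V r : ℝ}
  {τ : ℝ≥0}

theorem InTailClass.setIntegral_sq_le (hU : InTailClass ψ U P) (hV : variance U P ≤ V)
    (hr : 0 ≤ r) : ∫ ω in {ω | r * √V ≤ |U ω|}, U ω ^ 2 ∂P ≤ V * |ψ r| := by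
  have hsubset : {ω | r * √V ≤ |U ω|} ⊆ {ω | r * √(variance U P) ≤ |U ω|} := fun ω hω =>
    le_trans (mul_le_mul_of_nonneg_left (Real.sqrt_le_sqrt hV) hr) hω
  calc ∫ ω in {ω | r * √V ≤ |U ω|}, U ω ^ 2 ∂P
      ≤ ∫ ω in {ω | r * √(variance U P) ≤ |U ω|}, U ω ^ 2 ∂P :=
        setIntegral_mono_set hU.1.integrable_sq.integrableOn
          (Eventually.of_forall fun _ => sq_nonneg _) hsubset.eventuallyLE
    _ ≤ variance U P * |ψ r| := (hU.2 r hr).trans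
        (mul_le_mul_of_nonneg_left (le_abs_self _) (variance_nonneg _ _))
    _ ≤ V * |ψ r| := by gcongr

theorem InTailClass.integral_sq_le (hU : InTailClass ψ U P) (hV : variance U P ≤ V) :
    ∫ ω, U ω ^ 2 ∂P ≤ V * |ψ 0| := by
  simpa only [zero_mul, abs_nonneg, Set.ofPred_true, Measure.restrict_univ]
    using hU.setIntegral_sq_le hV le_rfl

theorem variance_add_gaussian (hA : MemLp A 2 P) (hZ : HasLaw Z (gaussianReal 0 τ) P)
    (hAZ : IndepFun A Z P) : variance (A + Z) P = variance A P + τ := by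
  rw [hAZ.variance_add hA (memLp_two_of_hasLaw_gaussianReal hZ), hZ.variance_eq,
    variance_id_gaussianReal]

theorem variance_add_gaussian_le (hA : MemLp A 2 P) (hZ : HasLaw Z (gaussianReal 0 τ) P)
    (hAZ : IndepFun A Z P) {K : ℝ} (hK : variance A P ≤ K) :
    variance (A + Z) P ≤ |K| + τ := by
  rw [variance_add_gaussian hA hZ hAZ]
  exact add_le_add_left (hK.trans (le_abs_self K)) _

theorem integral_sq_le_integral_add_gaussian_sq [IsProbabilityMeasure P] (hA : MemLp A 2 P)
    (hZ : HasLaw Z (gaussianReal 0 τ) P) (hAZ : IndepFun A Z P) :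
    ∫ ω, A ω ^ 2 ∂P ≤ ∫ ω, (A + Z) ω ^ 2 ∂P := by
  have hZ2 := memLp_two_of_hasLaw_gaussianReal hZ
  have hmean : ∫ ω, (A + Z) ω ∂P = ∫ ω, A ω ∂P := by
    rw [integral_add' (hA.integrable one_le_two) (hZ2.integrable one_le_two), hZ.integral_eq,
      integral_id_gaussianReal, add_zero]
  have hvarA := variance_eq_sub hA
  have hvar := variance_eq_sub (hA.add hZ2)
  rw [variance_add_gaussian hA hZ hAZ, hmean] at hvar
  simp only [Pi.pow_apply] at hvarA hvar
  linarith [τ.coe_nonneg]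

end TailClass

section Translation

variable {Ω : Type*} [MeasurableSpace Ω] {P : Measure Ω} {X Y : Ω → ℝ} {β : ℝ}

theorem Delta_add_const_right [IsFiniteMeasure P] (hX : AEMeasurable X P)
    (hY : AEMeasurable Y P) (hYd : HasSmoothDensity Y P) (hXYd : HasSmoothDensity (mix X Y β) P)
    (c : ℝ) : Delta X (fun ω => Y ω + c) β P = Delta X Y β P := by
  have hmix : mix X (fun ω => Y ω + c) β = fun ω => mix X Y β ω + √(1 - β) * c := by
    funext ω
    simp only [mix]
    ring
  have hXY : AEMeasurable (mix X Y β) P := (hX.const_mul _).add (hY.const_mul _)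
  simp only [Delta, scoreDefect, hmix, hYd.score_add_const hY, hXYd.score_add_const hXY]

theorem IsGaussianPerturbation.add_const_right {S T ZS ZT : Ω → ℝ} {τ : ℝ≥0}
    (hN : IsGaussianPerturbation S T ZS ZT τ P) (c : ℝ) :
    IsGaussianPerturbation S (fun ω => T ω + c) ZS ZT τ P where
  law_left := hN.law_left
  law_right := hN.law_right
  indep_noise := hN.indep_noise
  indep := hN.indep.comp (φ := fun q => (q.1, q.2 + c)) (by fun_prop) measurable_id

end Translation

section Rigidity

theorem abs_sub_affine_le_of_growth {F : ℝ → ℝ} {C A B x : ℝ} (hC : 0 ≤ C)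
    (hgrowth : ∀ y, |F y| ≤ C * (1 + |y|)) (hclose : ∀ y, |y| ≤ 1 → |F y - (A + B * y)| ≤ 1)
    (hx : 1 ≤ |x|) : |F x - (A + B * x)| ≤ (6 * C + 3) * |x| := by
  have hgrowth0 : |F 0| ≤ C := by simpa only [abs_zero, add_zero, mul_one] using hgrowth 0
  have hgrowth1 : |F 1| ≤ 2 * C := (hgrowth 1).trans_eq (by rw [abs_one]; ring)
  have hclose0 : |F 0 - A| ≤ 1 := by
    simpa only [mul_zero, add_zero] using hclose 0 (by rw [abs_zero]; exact zero_le_one)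
  have hclose1 : |F 1 - (A + B)| ≤ 1 := by
    simpa only [mul_one] using hclose 1 abs_one.le
  rw [abs_le] at hgrowth0 hgrowth1 hclose0 hclose1
  have hA : |A| ≤ C + 1 := abs_le.2 ⟨by linarith, by linarith⟩
  have hB : |B| ≤ 3 * C + 2 := abs_le.2 ⟨by linarith, by linarith⟩
  calc |F x - (A + B * x)| ≤ |F x| + |A + B * x| := abs_sub _ _
    _ ≤ |F x| + (|A| + |B| * |x|) := by
        gcongr
        exact (abs_add_le _ _).trans_eq (by rw [abs_mul])
    _ ≤ C * (1 + |x|) + (C + 1 + (3 * C + 2) * |x|) := by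
        gcongr
        exact hgrowth x
    _ ≤ (6 * C + 3) * |x| := by nlinarith

section SingleVariable

variable {Ω : Type*} [MeasurableSpace Ω] {P : Measure Ω} [IsProbabilityMeasure P]
  {A Z : Ω → ℝ} {τ : ℝ≥0} {K : ℝ}

theorem stdFisherInfo_add_gaussian_le (hτ : 0 < τ) (hA : MemLp A 2 P)
    (hZ : HasLaw Z (gaussianReal 0 τ) P) (hAZ : IndepFun A Z P) (hK : ∫ ω, A ω ^ 2 ∂P ≤ K) :
    stdFisherInfo (A + Z) P ≤
      variance (A + Z) P * ((2 * scoreGrowth τ K) ^ 2 * (1 + ∫ ω, (A + Z) ω ^ 2 ∂P)) := by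
  have hAZ2 := hA.add (memLp_two_of_hasLaw_gaussianReal hZ)
  have hgrowth := abs_score_add_gaussian_le hτ hA hZ hAZ hK
  have hC := (scoreGrowth_pos hτ K).le
  refine (HasSmoothDensity.stdFisherInfo_le_of_affine_approx
    (hasSmoothDensity_add_gaussian hτ hA.aemeasurable hZ hAZ) hAZ2
    (memLp_score_add_gaussian hτ hA hZ hAZ) (a := 0) (b := 0) (e := 2 * scoreGrowth τ K)
    (D := 2 * scoreGrowth τ K) (R := 1) (fun x hx => ?_) fun x hx => ?_).trans ?_
  · simpa only [zero_mul, add_zero, sub_zero] using (hgrowth x).trans (by nlinarith)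
  · simpa only [zero_mul, add_zero, sub_zero] using (hgrowth x).trans (by nlinarith)
  · have htail : ∫ ω in {ω | 1 ≤ |(A + Z) ω|}, (A + Z) ω ^ 2 ∂P ≤ ∫ ω, (A + Z) ω ^ 2 ∂P :=
      setIntegral_le_integral hAZ2.integrable_sq (Eventually.of_forall fun _ => sq_nonneg _)
    rw [mul_one_add]
    gcongr
    exact variance_nonneg _ _

theorem exists_stdFisherInfo_add_gaussian_le (hτ : 0 < τ) (ψ : ℝ → ℝ) (K : ℝ) :
    ∃ M > 0, ∀ {Ω : Type*} [MeasurableSpace Ω] {P : Measure Ω} [IsProbabilityMeasure P]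
      {A Z : Ω → ℝ}, MemLp A 2 P → HasLaw Z (gaussianReal 0 τ) P → IndepFun A Z P →
      variance A P ≤ K → InTailClass ψ (A + Z) P → stdFisherInfo (A + Z) P ≤ M := by
  set V := |K| + (τ : ℝ)
  have hC := scoreGrowth_pos hτ (V * |ψ 0|)
  refine ⟨V * ((2 * scoreGrowth τ (V * |ψ 0|)) ^ 2 * (1 + V * |ψ 0|)), by positivity, ?_⟩
  intro Ω _ P _ A Z hA hZ hAZ hK hψ
  have hvar := variance_add_gaussian_le hA hZ hAZ hK
  have hAZ2 := hψ.integral_sq_le hvar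
  have hA2 := (integral_sq_le_integral_add_gaussian_sq hA hZ hAZ).trans hAZ2
  refine (stdFisherInfo_add_gaussian_le hτ hA hZ hAZ hA2).trans ?_
  gcongr

theorem stdFisherInfo_add_gaussian_le_of_affine_approx (hτ : 0 < τ) (hA : MemLp A 2 P)
    (hZ : HasLaw Z (gaussianReal 0 τ) P) (hAZ : IndepFun A Z P) (hK : ∫ ω, A ω ^ 2 ∂P ≤ K)
    {a b e R : ℝ} (hR : 1 ≤ R) (he : e ≤ 1)
    (happrox : ∀ x, |x| ≤ R → |score (A + Z) P x - (a + b * x)| ≤ e) :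
    stdFisherInfo (A + Z) P ≤ variance (A + Z) P *
      (e ^ 2 + (6 * scoreGrowth τ K + 3) ^ 2 * ∫ ω in {ω | R ≤ |(A + Z) ω|}, (A + Z) ω ^ 2 ∂P) :=
  HasSmoothDensity.stdFisherInfo_le_of_affine_approx
    (hasSmoothDensity_add_gaussian hτ hA.aemeasurable hZ hAZ)
    (hA.add (memLp_two_of_hasLaw_gaussianReal hZ)) (memLp_score_add_gaussian hτ hA hZ hAZ)
    (fun x hx => happrox x hx.le) fun _ hx =>
      abs_sub_affine_le_of_growth (scoreGrowth_pos hτ K).le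
        (abs_score_add_gaussian_le hτ hA hZ hAZ hK)
        (fun y hy => (happrox y (hy.trans hR)).trans he) (hR.trans hx)

end SingleVariable

variable {τ : ℝ≥0}

theorem exists_affine_approx_score (hτ : 0 < τ) (K : ℝ) {R b₀ e : ℝ} (hR : 0 < R) (hb₀ : 0 < b₀)
    (he : 0 < e) :
    ∃ ε > 0, ∀ {Ω : Type*} [MeasurableSpace Ω] {P : Measure Ω} [IsProbabilityMeasure P]
      {S T ZS ZT : Ω → ℝ} {β : ℝ}, MemLp S 2 P → MemLp T 2 P →
      ∫ ω, S ω ^ 2 ∂P + ∫ ω, T ω ^ 2 ∂P ≤ K → IsGaussianPerturbation S T ZS ZT τ P →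
      β ∈ Set.Icc (0 : ℝ) 1 → b₀ ≤ √β → b₀ ≤ √(1 - β) → Delta (S + ZS) (T + ZT) β P < ε →
      ∃ a b, ∀ x, |x| ≤ R → |score (S + ZS) P x - (a + b * x)| ≤ e := by
  obtain ⟨ε, hε, hdefect⟩ :=
    exists_abs_scoreDefectAt_le hτ K (2 * R + R / b₀) (δ := e * b₀ / 12) (by positivity)
  refine ⟨ε, hε, fun {Ω} _ P _ S T ZS ZT β hS hT hK hN hβ hβ₁ hβ₂ hΔ => ?_⟩
  have happrox := exists_affine_approx_of_functional_eq
    (continuous_score_add_gaussian hτ hS hN.law_left hN.indepFun_left) hb₀ hβ₁ hβ₂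
    (Real.sqrt_le_one.2 hβ.2) hR (hdefect hS hT hK hN hβ hΔ)
  rwa [show 12 * (e * b₀ / 12) / b₀ = e by field_simp] at happrox

theorem exists_affine_approx_score_of_variance_le (hτ : 0 < τ) (K : ℝ) {R b₀ e : ℝ} (hR : 0 < R)
    (hb₀ : 0 < b₀) (he : 0 < e) :
    ∃ ε > 0, ∀ {Ω : Type*} [MeasurableSpace Ω] {P : Measure Ω} [IsProbabilityMeasure P]
      {S T ZS ZT : Ω → ℝ} {β : ℝ}, MemLp S 2 P → MemLp T 2 P →
      ∫ ω, S ω ^ 2 ∂P + variance T P ≤ K → IsGaussianPerturbation S T ZS ZT τ P →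
      β ∈ Set.Icc (0 : ℝ) 1 → b₀ ≤ √β → b₀ ≤ √(1 - β) → Delta (S + ZS) (T + ZT) β P < ε →
      ∃ a b, ∀ x, |x| ≤ R → |score (S + ZS) P x - (a + b * x)| ≤ e := by
  obtain ⟨ε, hε, happrox⟩ := exists_affine_approx_score hτ K hR hb₀ he
  refine ⟨ε, hε, fun {Ω} _ P _ S T ZS ZT β hS hT hK hN hβ hβ₁ hβ₂ hΔ => ?_⟩
  set T' : Ω → ℝ := fun ω => T ω + -∫ ω, T ω ∂P
  have hT' : MemLp T' 2 P := hT.add (memLp_const _)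
  have hvar : ∫ ω, T' ω ^ 2 ∂P = variance T P := by
    simp only [T', ← sub_eq_add_neg, variance_eq_integral hT.aemeasurable]
  have hDelta : Delta (S + ZS) (T' + ZT) β P = Delta (S + ZS) (T + ZT) β P := by
    have hshift : T' + ZT = fun ω => (T + ZT) ω + -∫ ω, T ω ∂P :=
      funext fun ω => add_right_comm _ _ _
    rw [hshift, Delta_add_const_right (hS.aemeasurable.add hN.law_left.aemeasurable)
      (hT.aemeasurable.add hN.law_right.aemeasurable)
      (hasSmoothDensity_add_gaussian hτ hT.aemeasurable hN.law_right hN.indepFun_right)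
      (hN.hasSmoothDensity_mix hτ hS.aemeasurable hT.aemeasurable hβ)]
  exact happrox hS hT' (hvar ▸ hK) (hN.add_const_right _) hβ hβ₁ hβ₂ (hDelta ▸ hΔ)

theorem exists_tail_radius {ψ : ℝ → ℝ} (hψ : Tendsto ψ atTop (𝓝 0)) {V η : ℝ} (hV : 0 < V)
    (hη : 0 < η) (D : ℝ) : ∃ r, 0 ≤ r ∧ 1 ≤ r * √V ∧ V * (D * (V * |ψ r|)) ≤ η := by
  have hlim : Tendsto (fun r => V * (D * (V * |ψ r|))) atTop (𝓝 0) := by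
    simpa only [abs_zero, mul_zero] using ((hψ.abs.const_mul V).const_mul D).const_mul V
  obtain ⟨r, hr, hψr⟩ :=
    ((eventually_ge_atTop (1 / √V)).and (hlim.eventually_le_const hη)).exists
  exact ⟨r, (by positivity : 0 ≤ 1 / √V).trans hr, (div_le_iff₀ (Real.sqrt_pos.2 hV)).1 hr, hψr⟩

theorem exists_stdFisherInfo_le_of_Delta_lt {ψ : ℝ → ℝ} (hψ : Tendsto ψ atTop (𝓝 0)) (hτ : 0 < τ)
    (K : ℝ) {b₀ η : ℝ} (hb₀ : 0 < b₀) (hη : 0 < η) :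
    ∃ ε > 0, ∀ {Ω : Type*} [MeasurableSpace Ω] {P : Measure Ω} [IsProbabilityMeasure P]
      {S T ZS ZT : Ω → ℝ} {β : ℝ}, MemLp S 2 P → MemLp T 2 P → variance S P ≤ K →
      variance T P ≤ K → IsGaussianPerturbation S T ZS ZT τ P → InTailClass ψ (S + ZS) P →
      β ∈ Set.Icc (0 : ℝ) 1 → b₀ ≤ √β → b₀ ≤ √(1 - β) → Delta (S + ZS) (T + ZT) β P < ε →
      stdFisherInfo (S + ZS) P ≤ η := by
  set V := |K| + (τ : ℝ)
  have hV : 0 < V := by positivity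
  set D := 6 * scoreGrowth τ (V * |ψ 0|) + 3
  obtain ⟨r, hr, hrV, htail⟩ := exists_tail_radius hψ hV (half_pos hη) (D ^ 2)
  obtain ⟨e, he, he1, hVe⟩ : ∃ e > 0, e ≤ 1 ∧ V * e ^ 2 ≤ η / 2 := by
    refine ⟨min 1 (√(η / 2 / V)), by positivity, min_le_left _ _, ?_⟩
    calc V * min 1 (√(η / 2 / V)) ^ 2 ≤ V * √(η / 2 / V) ^ 2 := by
          gcongr
          exact min_le_right _ _
      _ = η / 2 := by rw [Real.sq_sqrt (by positivity), mul_div_cancel₀ _ hV.ne']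
  obtain ⟨ε, hε, happrox⟩ := exists_affine_approx_score_of_variance_le hτ (V * |ψ 0| + K)
    (zero_lt_one.trans_le hrV) hb₀ he
  refine ⟨ε, hε, fun {Ω} _ P _ S T ZS ZT β hS hT hSK hTK hN hψX hβ hβ₁ hβ₂ hΔ => ?_⟩
  have hvar := variance_add_gaussian_le hS hN.law_left hN.indepFun_left hSK
  have hS2 := (integral_sq_le_integral_add_gaussian_sq hS hN.law_left hN.indepFun_left).trans
    (hψX.integral_sq_le hvar)
  obtain ⟨a, b, hab⟩ := happrox hS hT (add_le_add hS2 hTK) hN hβ hβ₁ hβ₂ hΔ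
  calc stdFisherInfo (S + ZS) P
      ≤ variance (S + ZS) P *
        (e ^ 2 + D ^ 2 * ∫ ω in {ω | r * √V ≤ |(S + ZS) ω|}, (S + ZS) ω ^ 2 ∂P) :=
        stdFisherInfo_add_gaussian_le_of_affine_approx hτ hS hN.law_left hN.indepFun_left hS2 hrV
          he1 hab
    _ ≤ V * (e ^ 2 + D ^ 2 * (V * |ψ r|)) := by
        gcongr
        exact hψX.setIntegral_sq_le hvar hr
    _ = V * e ^ 2 + V * (D ^ 2 * (V * |ψ r|)) := mul_add _ _ _
    _ ≤ η := by linarith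

theorem mul_one_sub_mul_le {β u v : ℝ} (hβ : β ∈ Set.Icc (0 : ℝ) 1) (hv : 0 ≤ v) (huv : u ≤ v) :
    β * (1 - β) * u ≤ v := by
  have hβ0 : 0 ≤ β * (1 - β) := mul_nonneg hβ.1 (sub_nonneg.2 hβ.2)
  have hβ1 : β * (1 - β) ≤ 1 := mul_le_one₀ hβ.2 (sub_nonneg.2 hβ.2) (sub_le_self 1 hβ.1)
  exact (mul_le_mul_of_nonneg_left huv hβ0).trans (mul_le_of_le_one_left hv hβ1)

theorem exists_mul_stdFisherInfo_le_of_Delta_lt {ψ : ℝ → ℝ} (hψ : Tendsto ψ atTop (𝓝 0))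
    (hτ : 0 < τ) (K : ℝ) {η : ℝ} (hη : 0 < η) :
    ∃ ε > 0, ∀ {Ω : Type*} [MeasurableSpace Ω] {P : Measure Ω} [IsProbabilityMeasure P]
      {S T ZS ZT : Ω → ℝ} {β : ℝ}, MemLp S 2 P → MemLp T 2 P → variance S P ≤ K →
      variance T P ≤ K → IsGaussianPerturbation S T ZS ZT τ P → InTailClass ψ (S + ZS) P →
      β ∈ Set.Icc (0 : ℝ) 1 → Delta (S + ZS) (T + ZT) β P < ε →
      β * (1 - β) * stdFisherInfo (S + ZS) P ≤ η := by
  obtain ⟨M, hM, hbound⟩ := exists_stdFisherInfo_add_gaussian_le hτ ψ K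
  obtain ⟨ε, hε, hsmall⟩ := exists_stdFisherInfo_le_of_Delta_lt hψ hτ K
    (b₀ := √(η / M)) (Real.sqrt_pos.2 (by positivity)) hη
  refine ⟨ε, hε, fun {Ω} _ P _ S T ZS ZT β hS hT hSK hTK hN hψX hβ hΔ => ?_⟩
  have hβ0 : 0 ≤ β * (1 - β) := mul_nonneg hβ.1 (sub_nonneg.2 hβ.2)
  rcases le_total (β * (1 - β)) (η / M) with hβη | hβη
  · calc β * (1 - β) * stdFisherInfo (S + ZS) P ≤ β * (1 - β) * M := by
          gcongr
          exact hbound hS hN.law_left hN.indepFun_left hSK hψX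
      _ ≤ η / M * M := by gcongr
      _ = η := div_mul_cancel₀ _ hM.ne'
  · exact mul_one_sub_mul_le hβ hη.le (hsmall hS hT hSK hTK hN hψX hβ
      (Real.sqrt_le_sqrt (by nlinarith [hβ.1])) (Real.sqrt_le_sqrt (by nlinarith [hβ.2])) hΔ)

end Rigidity

theorem exists_modulus {ε : ℝ → ℝ} (hε : ∀ η > 0, 0 < ε η) (M : ℝ) :
    ∃ ν : ℝ → ℝ, Tendsto ν (𝓝 0) (𝓝 0) ∧
      ∀ t v, v ≤ M → (∀ η > 0, t < ε η → v ≤ η) → v ≤ ν t := by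
  set bounds : ℝ → Set ℝ := fun t => {η | 0 < η ∧ (|t| < ε η ∨ M ≤ η)}
  have hpos (t : ℝ) : ∀ η ∈ bounds t, 0 ≤ η := fun η hη => hη.1.le
  refine ⟨fun t => sInf (bounds t), Metric.tendsto_nhds_nhds.2 fun η hη => ?_, fun t v hvM hv => ?_⟩
  · refine ⟨ε (η / 2), hε _ (half_pos hη), fun t ht => ?_⟩
    rw [dist_zero_right, Real.norm_eq_abs] at ht ⊢
    rw [abs_of_nonneg (Real.sInf_nonneg (hpos t))]
    exact (csInf_le ⟨0, hpos t⟩ ⟨half_pos hη, Or.inl ht⟩).trans_lt (half_lt_self hη)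
  · refine le_csInf ⟨max M 1, lt_max_of_lt_right one_pos, Or.inr (le_max_left _ _)⟩ ?_
    rintro η ⟨hη, ht | hMη⟩
    · exact hv η hη ((le_abs_self t).trans_lt ht)
    · exact hvM.trans hMη

theorem proposition2p3_general (ψ : ℝ → ℝ) (hψ : Tendsto ψ atTop (𝓝 0)) (τ : ℝ≥0) (hτ : 0 < τ)
    (K : ℝ) :
    ∃ ν : ℝ → ℝ, Tendsto ν (𝓝 0) (𝓝 0) ∧
      ∀ (Ω : Type*) [MeasurableSpace Ω] (P : Measure Ω) [IsProbabilityMeasure P]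
        (S T ZS ZT X Y : Ω → ℝ),
        MemLp S 2 P → MemLp T 2 P → variance S P ≤ K → variance T P ≤ K →
        IsGaussianPerturbation S T ZS ZT τ P →
        X = (fun ω => S ω + ZS ω) → Y = (fun ω => T ω + ZT ω) →
        InTailClass ψ X P →
        ∀ β : ℝ, 0 ≤ β → β ≤ 1 →
          HasSmoothDensity X P ∧ HasSmoothDensity Y P ∧ HasSmoothDensity (mix X Y β) P ∧
          Integrable (fun ω => score X P (X ω) ^ 2) P ∧
          Integrable (fun ω => scoreDefect X Y β P ω ^ 2) P ∧
          β * (1 - β) * stdFisherInfo X P ≤ ν (Delta X Y β P) := by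
  obtain ⟨M, hM, hbound⟩ := exists_stdFisherInfo_add_gaussian_le hτ ψ K
  choose! ε hε hsmall using fun (η : ℝ) (hη : 0 < η) =>
    exists_mul_stdFisherInfo_le_of_Delta_lt hψ hτ K hη
  obtain ⟨ν, hν, hle⟩ := exists_modulus hε M
  refine ⟨ν, hν, ?_⟩
  rintro Ω _ P _ S T ZS ZT _ _ hS hT hSK hTK hN rfl rfl hψX β hβ0 hβ1
  have hβ : β ∈ Set.Icc (0 : ℝ) 1 := ⟨hβ0, hβ1⟩
  have hJM := hbound hS hN.law_left hN.indepFun_left hSK hψX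
  refine ⟨hasSmoothDensity_add_gaussian hτ hS.aemeasurable hN.law_left hN.indepFun_left,
    hasSmoothDensity_add_gaussian hτ hT.aemeasurable hN.law_right hN.indepFun_right,
    hN.hasSmoothDensity_mix hτ hS.aemeasurable hT.aemeasurable hβ,
    (memLp_score_add_gaussian hτ hS hN.law_left hN.indepFun_left).integrable_sq,
    (hN.memLp_scoreDefect hτ hS hT hβ).integrable_sq,
    hle _ _ (mul_one_sub_mul_le hβ hM.le hJM) fun η hη hΔ =>
      hsmall η hη hS hT hSK hTK hN hψX hβ hΔ⟩

theorem proposition2p3 (ψ : ℝ → ℝ) (hψ : Tendsto ψ atTop (𝓝 0)) (τ : ℝ≥0) (hτ : 0 < τ) (K : ℝ) :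
    ∃ ν : ℝ → ℝ, Tendsto ν (𝓝 0) (𝓝 0) ∧
      ∀ (Ω : Type*) [MeasurableSpace Ω] (P : Measure Ω) [IsProbabilityMeasure P]
        (S T ZS ZT X Y : Ω → ℝ),
        MemLp S 2 P → MemLp T 2 P → variance S P ≤ K → variance T P ≤ K →
        IsGaussianPerturbation S T ZS ZT τ P →
        X = (fun ω => S ω + ZS ω) → Y = (fun ω => T ω + ZT ω) →
        InTailClass ψ X P → InTailClass ψ Y P →
        ∀ β : ℝ, 0 ≤ β → β ≤ 1 →
          HasSmoothDensity X P ∧ HasSmoothDensity Y P ∧ HasSmoothDensity (mix X Y β) P ∧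
          Integrable (fun ω => score X P (X ω) ^ 2) P ∧
          Integrable (fun ω => scoreDefect X Y β P ω ^ 2) P ∧
          β * (1 - β) * stdFisherInfo X P ≤ ν (Delta X Y β P) := by
  obtain ⟨ν, hν, h⟩ := proposition2p3_general ψ hψ τ hτ K
  exact ⟨ν, hν, fun Ω _ P _ S T ZS ZT X Y hS hT hSK hTK hN hX hY hψX _ =>
    h Ω P S T ZS ZT X Y hS hT hSK hTK hN hX hY hψX⟩
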